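/- Let $n \ge 1$, $0<\alpha<1$, and let $\Omega\subset\mathbb R^n$ be a bounded domain (nonempty, open, connected) with $C^{4,\alpha}$-smooth boundary: for every $x_0\in\partial\Omega$ there are a neighbourhood $V$ of $x_0$, a neighbourhood $U$ of $0$ and a $C^{4,\alpha}$ diffeomorphism $\psi:U\to V$ with $\psi(U\cap\{z_n=0\})=\partial\Omega\cap V$ and $\psi(U\cap\{z_n>0\})=\Omega\cap V$. Let $$Lu=\sum_{i,j=1}^n a_{ij}\,\partial_i\partial_j u+\sum_{i=1}^n b_i\,\partial_i u+c\,u$$ with coefficients $a_{ij},b_i,c\in C^{2,\alpha}(\overline\Omega)$, where the matrix $(a_{ij}(x))$ is symmetric for all $x \in \overline\Omega$ and uniformly elliptic: there is $\lambda>0$ with $\sum_{i,j}a_{ij}(x)\xi_i\xi_j\ge\lambda|\xi|^2$ for all $x\in\overline\Omega$, $\xi\in\mathbb R^n$. Here $C^{2,\alpha}(\overline\Omega)$ is the space of continuous functions on $\overline\Omega$ that are twice continuously differentiable in $\Omega$, whose first and second derivatives extend continuously to $\overline\Omega$, and whose second derivatives are $\alpha$-Hölder continuous, with norm $\|u\|_{C^{2,\alpha}}=\sum_{j\le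 2}\sup_{\Omega}|D^ju|+[D^2u]_{\alpha,\Omega}$. Put $$D(L)=\{u\in C^{2,\alpha}(\overline\Omega)\;:\;u=Lu=0\text{ on }\partial\Omega\},$$ where at boundary points $Lu$ is formed with the continuous extensions of the derivatives of $u$. Let $C_c^{2,\alpha}(\mathbb R^n)$ be the space of compactly supported $C^2$ functions on $\mathbb R^n$ with $\alpha$-Hölder continuous second derivatives, with the norm $\|\cdot\|_{C^{2,\alpha}}$ taken over $\mathbb R^n$. Then there is an injective linear operator $E:D(L)\to C_c^{2,\alpha}(\mathbb R^n)$ and a constant $C<\infty$ such that for all $u\in D(L)$: $$\|Eu\|_{C^{2,\alpha}(\mathbb R^n)}\le C\,\|u\|_{C^{2,\alpha}(\overline\Omega)},\qquad Eu|_{\overline\Omega}=u,\qquad \sup_{x\in\mathbb R^n}|Eu(x)|=\sup_{x\in\Omega}|u(x)|.$$ -/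

import Mathlib

open scoped NNReal ENNReal Topology

/-- The Euclidean space `ℝⁿ`. -/
abbrev Rn (n : ℕ) : Type := EuclideanSpace ℝ (Fin n)

/-- The closure of an open set `Ω ⊆ ℝⁿ`, as a type. -/
abbrev Clo {n : ℕ} (Ω : TopologicalSpace.Opens (Rn n)) : Type :=
  {x : Rn n // x ∈ closure (Ω : Set (Rn n))}

noncomputable section

/-- The extension by zero to `ℝⁿ` of a function on `closure Ω`. It is used only to speak about
derivatives at points of the open set `Ω`, where the values outside `Ω` play no role. -/
def zeroExt {n : ℕ} (Ω : TopologicalSpace.Opens (Rn n)) (u : Clo Ω → ℝ) : Rn n → ℝ :=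
  Function.extend Subtype.val u 0

theorem zeroExt_add {n : ℕ} (Ω : TopologicalSpace.Opens (Rn n)) (u v : Clo Ω → ℝ) :
    zeroExt Ω (u + v) = zeroExt Ω u + zeroExt Ω v := by
  funext x
  by_cases hx : ∃ y : Clo Ω, y.val = x
  · obtain ⟨y, rfl⟩ := hx
    simp [zeroExt]
  · simp [zeroExt, Function.extend_apply' _ _ _ hx]

theorem zeroExt_smul {n : ℕ} (Ω : TopologicalSpace.Opens (Rn n)) (r : ℝ) (u : Clo Ω → ℝ) :
    zeroExt Ω (r • u) = r • zeroExt Ω u := by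
  funext x
  by_cases hx : ∃ y : Clo Ω, y.val = x
  · obtain ⟨y, rfl⟩ := hx
    simp [zeroExt]
  · simp [zeroExt, Function.extend_apply' _ _ _ hx]

theorem zeroExt_zero {n : ℕ} (Ω : TopologicalSpace.Opens (Rn n)) :
    zeroExt Ω (0 : Clo Ω → ℝ) = 0 := by
  simpa using zeroExt_smul Ω 0 (0 : Clo Ω → ℝ)

/-- The `j`-th Fréchet derivative, in `Ω`, of a function `u` on `closure Ω`. -/
def innerDeriv {n : ℕ} (Ω : TopologicalSpace.Opens (Rn n)) (j : ℕ) (u : Clo Ω → ℝ) :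
    Rn n → ContinuousMultilinearMap ℝ (fun _ : Fin j => Rn n) ℝ :=
  iteratedFDeriv ℝ j (zeroExt Ω u)

/-- `u ∈ C^{k,α}(closure Ω)`: `u` is continuous on `closure Ω` and `k` times continuously
differentiable in `Ω`, its derivatives of order at most `k` have continuous extensions to
`closure Ω`, and those of order `k` are (uniformly) `α`-Hölder continuous. -/
structure IsHolderUpToBoundary {n : ℕ} (k : ℕ) (α : ℝ≥0) (Ω : TopologicalSpace.Opens (Rn n))
    (u : Clo Ω → ℝ) : Prop where
  continuous : Continuous u
  contDiffOn : ContDiffOn ℝ k (zeroExt Ω u) (Ω : Set (Rn n))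
  extends_cont : ∀ j ≤ k, ∃ g : Clo Ω → ContinuousMultilinearMap ℝ (fun _ : Fin j => Rn n) ℝ,
    Continuous g ∧ ∀ x : Clo Ω, x.val ∈ Ω → g x = innerDeriv Ω j u x.val
  holder : ∃ K : ℝ≥0, HolderOnWith K α (innerDeriv Ω k u) (Ω : Set (Rn n))

theorem innerDeriv_add {n k j : ℕ} {α : ℝ≥0} {Ω : TopologicalSpace.Opens (Rn n)}
    {u v : Clo Ω → ℝ} (hu : IsHolderUpToBoundary k α Ω u) (hv : IsHolderUpToBoundary k α Ω v)
    (hj : j ≤ k) {x : Rn n} (hx : x ∈ Ω) :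
    innerDeriv Ω j (u + v) x = innerDeriv Ω j u x + innerDeriv Ω j v x := by
  have hn := Ω.isOpen.mem_nhds hx
  have hjk : (j : WithTop ℕ∞) ≤ k := by exact_mod_cast hj
  simp only [innerDeriv, zeroExt_add]
  exact iteratedFDeriv_add_apply ((hu.contDiffOn.contDiffAt hn).of_le hjk)
    ((hv.contDiffOn.contDiffAt hn).of_le hjk)

theorem innerDeriv_smul {n k j : ℕ} {α : ℝ≥0} {Ω : TopologicalSpace.Opens (Rn n)}
    {u : Clo Ω → ℝ} (hu : IsHolderUpToBoundary k α Ω u) (r : ℝ)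
    (hj : j ≤ k) {x : Rn n} (hx : x ∈ Ω) :
    innerDeriv Ω j (r • u) x = r • innerDeriv Ω j u x := by
  have hn := Ω.isOpen.mem_nhds hx
  have hjk : (j : WithTop ℕ∞) ≤ k := by exact_mod_cast hj
  simp only [innerDeriv, zeroExt_smul]
  exact iteratedFDeriv_const_smul_apply ((hu.contDiffOn.contDiffAt hn).of_le hjk)

theorem innerDeriv_zero {n j : ℕ} (Ω : TopologicalSpace.Opens (Rn n)) (x : Rn n) :
    innerDeriv Ω j (0 : Clo Ω → ℝ) x = 0 := by
  rw [innerDeriv, zeroExt_zero]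
  simp [Pi.zero_def]

theorem IsHolderUpToBoundary.add {n k : ℕ} {α : ℝ≥0} {Ω : TopologicalSpace.Opens (Rn n)}
    {u v : Clo Ω → ℝ} (hu : IsHolderUpToBoundary k α Ω u) (hv : IsHolderUpToBoundary k α Ω v) :
    IsHolderUpToBoundary k α Ω (u + v) where
  continuous := hu.continuous.add hv.continuous
  contDiffOn := by rw [zeroExt_add]; exact hu.contDiffOn.add hv.contDiffOn
  extends_cont := by
    intro j hj
    obtain ⟨g, hg, hg'⟩ := hu.extends_cont j hj
    obtain ⟨h, hh, hh'⟩ := hv.extends_cont j hj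
    exact ⟨fun x => g x + h x, hg.add hh, fun x hx => by
      rw [innerDeriv_add hu hv hj hx, ← hg' x hx, ← hh' x hx]⟩
  holder := by
    obtain ⟨K, hK⟩ := hu.holder
    obtain ⟨M, hM⟩ := hv.holder
    refine ⟨K + M, fun x hx y hy => ?_⟩
    rw [innerDeriv_add hu hv le_rfl hx, innerDeriv_add hu hv le_rfl hy]
    refine (edist_add_add_le _ _ _ _).trans ?_
    rw [ENNReal.coe_add, add_mul]
    exact add_le_add (hK x hx y hy) (hM x hx y hy)

theorem IsHolderUpToBoundary.smul {n k : ℕ} {α : ℝ≥0} {Ω : TopologicalSpace.Opens (Rn n)}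
    {u : Clo Ω → ℝ} (r : ℝ) (hu : IsHolderUpToBoundary k α Ω u) :
    IsHolderUpToBoundary k α Ω (r • u) where
  continuous := hu.continuous.const_smul r
  contDiffOn := by rw [zeroExt_smul]; exact hu.contDiffOn.const_smul r
  extends_cont := by
    intro j hj
    obtain ⟨g, hg, hg'⟩ := hu.extends_cont j hj
    exact ⟨fun x => r • g x, hg.const_smul r, fun x hx => by
      rw [innerDeriv_smul hu r hj hx, ← hg' x hx]⟩
  holder := by
    obtain ⟨K, hK⟩ := hu.holder
    refine ⟨‖r‖₊ * K, fun x hx y hy => ?_⟩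
    rw [innerDeriv_smul hu r le_rfl hx, innerDeriv_smul hu r le_rfl hy]
    refine (edist_smul_le r (innerDeriv Ω k u x) (innerDeriv Ω k u y)).trans ?_
    rw [ENNReal.coe_mul, mul_assoc, ENNReal.smul_def, smul_eq_mul]
    gcongr
    exact hK x hx y hy

theorem IsHolderUpToBoundary.zero {n : ℕ} (k : ℕ) (α : ℝ≥0)
    (Ω : TopologicalSpace.Opens (Rn n)) : IsHolderUpToBoundary k α Ω (0 : Clo Ω → ℝ) where
  continuous := continuous_zero
  contDiffOn := by rw [zeroExt_zero]; exact contDiffOn_const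
  extends_cont := fun j _ => ⟨fun _ => 0, continuous_const, fun x _ => (innerDeriv_zero Ω _).symm⟩
  holder := ⟨0, fun x _ y _ => by simp [innerDeriv_zero]⟩

/-- The continuous extension to `closure Ω` of the `j`-th derivative in `Ω`. -/
def derivExt {n : ℕ} (Ω : TopologicalSpace.Opens (Rn n)) (j : ℕ) (u : Clo Ω → ℝ)
    (x : Clo Ω) : ContinuousMultilinearMap ℝ (fun _ : Fin j => Rn n) ℝ :=
  extendFrom (Ω : Set (Rn n)) (innerDeriv Ω j u) x.val

theorem IsHolderUpToBoundary.tendsto_derivExt {n k j : ℕ} {α : ℝ≥0}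
    {Ω : TopologicalSpace.Opens (Rn n)} {u : Clo Ω → ℝ} (hu : IsHolderUpToBoundary k α Ω u)
    (hj : j ≤ k) (x : Clo Ω) :
    Filter.Tendsto (innerDeriv Ω j u) (𝓝[(Ω : Set (Rn n))] x.val) (𝓝 (derivExt Ω j u x)) := by
  obtain ⟨g, hg, hg'⟩ := hu.extends_cont j hj
  refine tendsto_extendFrom ⟨g x, ?_⟩
  have hmap : Filter.map (Subtype.val : Clo Ω → Rn n)
      (𝓝[Subtype.val ⁻¹' (Ω : Set (Rn n))] x) = 𝓝[(Ω : Set (Rn n))] x.val := by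
    have h1 := (Topology.IsEmbedding.subtypeVal
      (p := fun y => y ∈ closure (Ω : Set (Rn n)))).map_nhdsWithin_eq
        (Subtype.val ⁻¹' (Ω : Set (Rn n))) x
    rw [h1, Subtype.image_preimage_coe]
    congr 1
    exact Set.inter_eq_right.2 subset_closure
  rw [← hmap, Filter.tendsto_map'_iff]
  refine (hg.continuousAt.tendsto.mono_left nhdsWithin_le_nhds).congr' ?_
  filter_upwards [self_mem_nhdsWithin] with y hy
  exact hg' y hy

theorem derivExt_eq {n j : ℕ} {Ω : TopologicalSpace.Opens (Rn n)} {u : Clo Ω → ℝ} {x : Clo Ω}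
    {g : ContinuousMultilinearMap ℝ (fun _ : Fin j => Rn n) ℝ}
    (h : Filter.Tendsto (innerDeriv Ω j u) (𝓝[(Ω : Set (Rn n))] x.val) (𝓝 g)) :
    derivExt Ω j u x = g :=
  extendFrom_eq x.2 h

theorem derivExt_add {n k j : ℕ} {α : ℝ≥0} {Ω : TopologicalSpace.Opens (Rn n)}
    {u v : Clo Ω → ℝ} (hu : IsHolderUpToBoundary k α Ω u) (hv : IsHolderUpToBoundary k α Ω v)
    (hj : j ≤ k) (x : Clo Ω) :
    derivExt Ω j (u + v) x = derivExt Ω j u x + derivExt Ω j v x := by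
  refine derivExt_eq (((hu.tendsto_derivExt hj x).add (hv.tendsto_derivExt hj x)).congr' ?_)
  filter_upwards [self_mem_nhdsWithin] with y hy
  exact (innerDeriv_add hu hv hj hy).symm

theorem derivExt_smul {n k j : ℕ} {α : ℝ≥0} {Ω : TopologicalSpace.Opens (Rn n)}
    {u : Clo Ω → ℝ} (hu : IsHolderUpToBoundary k α Ω u) (r : ℝ) (hj : j ≤ k) (x : Clo Ω) :
    derivExt Ω j (r • u) x = r • derivExt Ω j u x := by
  refine derivExt_eq (((hu.tendsto_derivExt hj x).const_smul r).congr' ?_)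
  filter_upwards [self_mem_nhdsWithin] with y hy
  exact (innerDeriv_smul hu r hj hy).symm

/-- The `i`-th standard unit vector. -/
def unitVec {n : ℕ} (i : Fin n) : Rn n := EuclideanSpace.single i 1

/-- `Lu = ∑ aᵢⱼ ∂ᵢ∂ⱼ u + ∑ bᵢ ∂ᵢ u + c u` on `closure Ω`, where at boundary points the derivatives
of `u` are the continuous extensions of the derivatives in `Ω`. -/
def diffOp {n : ℕ} (Ω : TopologicalSpace.Opens (Rn n)) (a : Clo Ω → Matrix (Fin n) (Fin n) ℝ)
    (b : Clo Ω → Fin n → ℝ) (c : Clo Ω → ℝ) (u : Clo Ω → ℝ) (x : Clo Ω) : ℝ :=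
  (∑ i, ∑ j, a x i j * derivExt Ω 2 u x ![unitVec i, unitVec j]) +
    (∑ i, b x i * derivExt Ω 1 u x ![unitVec i]) + c x * u x

theorem diffOp_add {n : ℕ} {α : ℝ≥0} {Ω : TopologicalSpace.Opens (Rn n)}
    (a : Clo Ω → Matrix (Fin n) (Fin n) ℝ) (b : Clo Ω → Fin n → ℝ) (c : Clo Ω → ℝ)
    {u v : Clo Ω → ℝ} (hu : IsHolderUpToBoundary 2 α Ω u) (hv : IsHolderUpToBoundary 2 α Ω v)
    (x : Clo Ω) :
    diffOp Ω a b c (u + v) x = diffOp Ω a b c u x + diffOp Ω a b c v x := by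
  simp only [diffOp, derivExt_add hu hv le_rfl, derivExt_add hu hv one_le_two, Pi.add_apply,
    add_apply, mul_add, Finset.sum_add_distrib]
  ring

theorem diffOp_smul {n : ℕ} {α : ℝ≥0} {Ω : TopologicalSpace.Opens (Rn n)}
    (a : Clo Ω → Matrix (Fin n) (Fin n) ℝ) (b : Clo Ω → Fin n → ℝ) (c : Clo Ω → ℝ)
    {u : Clo Ω → ℝ} (hu : IsHolderUpToBoundary 2 α Ω u) (r : ℝ) (x : Clo Ω) :
    diffOp Ω a b c (r • u) x = r * diffOp Ω a b c u x := by
  simp only [diffOp, derivExt_smul hu r le_rfl, derivExt_smul hu r one_le_two, Pi.smul_apply,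
    smul_apply, smul_eq_mul, mul_add, Finset.mul_sum]
  simp only [mul_left_comm]

/-- `D(L) = {u ∈ C^{2,α}(closure Ω) | u = Lu = 0 on ∂Ω}`. -/
def opDomain {n : ℕ} (α : ℝ≥0) (Ω : TopologicalSpace.Opens (Rn n))
    (a : Clo Ω → Matrix (Fin n) (Fin n) ℝ) (b : Clo Ω → Fin n → ℝ) (c : Clo Ω → ℝ) :
    Submodule ℝ (Clo Ω → ℝ) where
  carrier := {u | IsHolderUpToBoundary 2 α Ω u ∧
    ∀ x : Clo Ω, x.val ∈ frontier (Ω : Set (Rn n)) → u x = 0 ∧ diffOp Ω a b c u x = 0}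
  add_mem' := by
    rintro u v ⟨hu, hu0⟩ ⟨hv, hv0⟩
    refine ⟨hu.add hv, fun x hx => ⟨?_, ?_⟩⟩
    · simp [(hu0 x hx).1, (hv0 x hx).1]
    · rw [diffOp_add a b c hu hv, (hu0 x hx).2, (hv0 x hx).2, add_zero]
  zero_mem' := by
    refine ⟨IsHolderUpToBoundary.zero 2 α Ω, fun x _ => ⟨rfl, ?_⟩⟩
    simpa using diffOp_smul a b c (IsHolderUpToBoundary.zero 2 α Ω) 0 x
  smul_mem' := by
    rintro r u ⟨hu, hu0⟩
    refine ⟨hu.smul r, fun x hx => ⟨?_, ?_⟩⟩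
    · simp [(hu0 x hx).1]
    · rw [diffOp_smul a b c hu, (hu0 x hx).2, mul_zero]

/-- `C_c^{k,α}(ℝⁿ)`: the compactly supported `C^k` functions on `ℝⁿ` whose `k`-th derivative is
`α`-Hölder continuous. -/
def compactHolder (n k : ℕ) (α : ℝ≥0) : Submodule ℝ (Rn n → ℝ) where
  carrier := {f | ContDiff ℝ k f ∧ HasCompactSupport f ∧
    ∃ K : ℝ≥0, HolderWith K α (iteratedFDeriv ℝ k f)}
  add_mem' := by
    rintro f g ⟨hf, hfc, K, hK⟩ ⟨hg, hgc, M, hM⟩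
    refine ⟨hf.add hg, hfc.add hgc, K + M, ?_⟩
    rw [iteratedFDeriv_add hf hg]
    exact hK.add hM
  zero_mem' := by
    refine ⟨contDiff_const, HasCompactSupport.zero, 0, fun x y => ?_⟩
    simp [Pi.zero_def]
  smul_mem' := by
    rintro r f ⟨hf, hfc, K, hK⟩
    refine ⟨hf.const_smul r, hfc.smul_left (f := fun _ => r), K * ‖r‖₊, ?_⟩
    have h : iteratedFDeriv ℝ k (r • f) = r • iteratedFDeriv ℝ k f := by
      funext x
      exact iteratedFDeriv_const_smul_apply hf.contDiffAt
    rw [h]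
    exact hK.smul r

/-- The `C^{k,α}` norm over an open set `S`, with values in `[0, ∞]`:
`∑_{j ≤ k} sup_S |D^j f| + [D^k f]_{α, S}`. -/
def holderNorm {n : ℕ} (k : ℕ) (α : ℝ≥0) (S : Set (Rn n)) (f : Rn n → ℝ) : ℝ≥0∞ :=
  (∑ j ∈ Finset.range (k + 1), ⨆ x ∈ S, ‖iteratedFDeriv ℝ j f x‖ₑ) +
    eHolderNorm α (S.domRestrict (iteratedFDeriv ℝ k f))

/-- A map of class `C^{k,α}` in the open set `U`: it is `C^k` there and its `k`-th derivative is
locally `α`-Hölder continuous. -/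
def IsHolderMapOn {n : ℕ} (k : ℕ) (α : ℝ≥0) (f : Rn n → Rn n) (U : Set (Rn n)) : Prop :=
  ContDiffOn ℝ k f U ∧
    ∀ x ∈ U, ∃ W ∈ 𝓝 x, ∃ K : ℝ≥0, HolderOnWith K α (iteratedFDeriv ℝ k f) W

/-- `Ω ⊆ ℝⁿ`, with `n = d + 1`, is a `C^{k,α}`-smooth domain: near each boundary point `x₀` there
is a `C^{k,α}` diffeomorphism `ψ : U → V` from a neighbourhood `U` of `0` to a neighbourhood `V` of
`x₀` with `ψ(U ∩ {zₙ = 0}) = ∂Ω ∩ V` and `ψ(U ∩ {zₙ > 0}) = Ω ∩ V`. -/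
def IsHolderSmooth {d : ℕ} (k : ℕ) (α : ℝ≥0) (Ω : Set (Rn (d + 1))) : Prop :=
  ∀ x₀ ∈ frontier Ω, ∃ ψ : OpenPartialHomeomorph (Rn (d + 1)) (Rn (d + 1)),
    0 ∈ ψ.source ∧ x₀ ∈ ψ.target ∧
    IsHolderMapOn k α ψ ψ.source ∧ IsHolderMapOn k α ψ.symm ψ.target ∧
    ψ '' (ψ.source ∩ {z | z (Fin.last d) = 0}) = frontier Ω ∩ ψ.target ∧
    ψ '' (ψ.source ∩ {z | 0 < z (Fin.last d)}) = Ω ∩ ψ.target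

/-- The coefficient matrix `a` is uniformly elliptic with ellipticity constant `lam`. -/
def IsUniformlyElliptic {n : ℕ} (Ω : TopologicalSpace.Opens (Rn n))
    (a : Clo Ω → Matrix (Fin n) (Fin n) ℝ) (lam : ℝ) : Prop :=
  ∀ (x : Clo Ω) (ξ : Rn n), lam * ‖ξ‖ ^ 2 ≤ ∑ i, ∑ j, a x i j * ξ i * ξ j

end

/-! Near a boundary point flatten the boundary by a chart `ψ` with inverse `φ`, and let `τ` be the
last coordinate, `e` its unit vector and `v = u ∘ ψ`. The function `v` vanishes on `τ = 0`, and the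
plain odd reflection `-v(z - 2 τ(z) e)` matches its value, its gradient and its mixed second
derivatives there. Only the normal second derivative `v_ee` comes out with the wrong sign.

The cure is to bend the reflection and replace it by `-v(S(z - 2 τ(z) e))`, where `S z = z + τ(z)
q(z) + τ(z)² κ(z) e` and `q` is tangential. This matches the second derivatives exactly when `v_ee +
D²v(e, q) + κ v_e = 0` on the hyperplane. Since `u = 0` on the boundary, the condition `Lu = 0`
reads there `2 D²v(e, X) - τ(X) v_ee + τ(Y) v_e = 0` (`boundary_operator_eq`). Here `X` is the image
of the conormal vector under `Dφ`, and `Y` collects the terms with `D²φ` and the first-order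
coefficients. By ellipticity `τ(X)` is bounded below (`normal_component_lower_bound`), so division
by it gives the required relation with `q = 2 X / τ(X) - 2 e` and `κ = τ(Y) / τ(X)`. These are of
class `C^{2,α}` because `φ` is `C^{4,α}` and the coefficients are `C^{2,α}`.

The map `S` depends on the chart and the operator but not on `u`, so each local extension is linear
in `u`. Every value of it is plus or minus a value of `u`, or zero. A partition of unity glues the
local extensions (`exists_extension_of_local`): it sums to one on the closure of `Ω`, so `u` is
reproduced there and injectivity is immediate. It sums to at most one elsewhere, so the supremum
does not grow.

The carrying lemmas are `JetTendsto.eq_of_vanishing` and `JetTendsto.reflection_eq` for the matching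
of derivatives, `HolderBd.glue_two` for gluing across the hyperplane, `HolderBd.exists_reflection`
for the flat picture, and `jet_condition_of_mem_opDomain` for the boundary condition. -/

/-! ### Quantitative calculus of `C^{k,α}` functions. -/

section HolderCalculus

variable {E E' F G H : Type} [NormedAddCommGroup E] [NormedSpace ℝ E] [NormedAddCommGroup E']
  [NormedSpace ℝ E'] [NormedAddCommGroup F] [NormedSpace ℝ F] [NormedAddCommGroup G]
  [NormedSpace ℝ G] [NormedAddCommGroup H] [NormedSpace ℝ H]

/-- `f` is `k` times differentiable on `S`, its derivatives of order at most `k` are bounded by `M`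
on `S`, and the one of order `k` is `α`-Hölder continuous on `S` with constant `M`. -/
def HolderBd (α : ℝ) (S : Set E) (M : ℝ) : ∀ (_ : ℕ) {F : Type} [NormedAddCommGroup F]
    [NormedSpace ℝ F] (_ : E → F), Prop
  | 0, _, _, _, f => 0 ≤ M ∧ (∀ x ∈ S, ‖f x‖ ≤ M) ∧ ∀ x ∈ S, ∀ y ∈ S, ‖f x - f y‖ ≤ M * ‖x - y‖ ^ α
  | k + 1, _, _, _, f =>
    DifferentiableOn ℝ f S ∧ (∀ x ∈ S, ‖f x‖ ≤ M) ∧ HolderBd α S M k (fderiv ℝ f)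

/-- Open convex sets of diameter at most one. -/
structure SmallConvex (S : Set E) : Prop where
  isOpen : IsOpen S
  convex : Convex ℝ S
  dist_le : ∀ x ∈ S, ∀ y ∈ S, ‖x - y‖ ≤ 1

variable {α M N : ℝ} {S T : Set E} {k : ℕ}

theorem HolderBd.nonneg {f : E → F} (h : HolderBd α S M k f) : 0 ≤ M := by
  induction k generalizing F with
  | zero => exact h.1
  | succ k ih => exact ih h.2.2

theorem HolderBd.bound {f : E → F} (h : HolderBd α S M k f) : ∀ x ∈ S, ‖f x‖ ≤ M := by
  cases k with
  | zero => exact h.2.1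
  | succ k => exact h.2.1

theorem HolderBd.mono_const {f : E → F} (h : HolderBd α S M k f) (hMN : M ≤ N) :
    HolderBd α S N k f := by
  induction k generalizing F with
  | zero =>
    exact ⟨h.1.trans hMN, fun x hx => (h.2.1 x hx).trans hMN, fun x hx y hy =>
      (h.2.2 x hx y hy).trans (by gcongr)⟩
  | succ k ih => exact ⟨h.1, fun x hx => (h.2.1 x hx).trans hMN, ih h.2.2⟩

theorem HolderBd.mono_set {f : E → F} (h : HolderBd α S M k f) (hTS : T ⊆ S) :
    HolderBd α T M k f := by
  induction k generalizing F with
  | zero => exact ⟨h.1, fun x hx => h.2.1 x (hTS hx), fun x hx y hy => h.2.2 x (hTS hx) y (hTS hy)⟩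
  | succ k ih => exact ⟨h.1.mono hTS, fun x hx => h.2.1 x (hTS hx), ih h.2.2⟩

theorem HolderBd.congr {f g : E → F} (h : HolderBd α S M k f) (hS : IsOpen S)
    (hfg : Set.EqOn f g S) : HolderBd α S M k g := by
  induction k generalizing F with
  | zero =>
    refine ⟨h.1, fun x hx => ?_, fun x hx y hy => ?_⟩
    · rw [← hfg hx]; exact h.2.1 x hx
    · rw [← hfg hx, ← hfg hy]; exact h.2.2 x hx y hy
  | succ k ih =>
    refine ⟨h.1.congr fun x hx => (hfg hx).symm, fun x hx => ?_, ih h.2.2 fun x hx => ?_⟩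
    · rw [← hfg hx]; exact h.2.1 x hx
    · exact (Filter.eventuallyEq_of_mem (hS.mem_nhds hx) hfg).fderiv_eq

theorem HolderBd.differentiableAt {f : E → F} (h : HolderBd α S M (k + 1) f) (hS : IsOpen S)
    {x : E} (hx : x ∈ S) : DifferentiableAt ℝ f x :=
  (h.1 x hx).differentiableAt (hS.mem_nhds hx)

theorem HolderBd.lipschitz {f : E → F} (h : HolderBd α S M (k + 1) f) (hS : SmallConvex S) :
    ∀ x ∈ S, ∀ y ∈ S, ‖f x - f y‖ ≤ M * ‖x - y‖ := fun x hx y hy =>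
  hS.convex.norm_image_sub_le_of_norm_fderiv_le
    (fun z hz => h.differentiableAt hS.isOpen hz) h.2.2.bound hy hx

/-- Distances at most one satisfy `t ≤ t ^ α`, so passing from Lipschitz to Hölder costs no
constant. This is the reason for the diameter bound in `SmallConvex`. -/
theorem HolderBd.of_lipschitz {f : E → F} (hα : α ≤ 1) (hM : 0 ≤ M)
    (hS : ∀ x ∈ S, ∀ y ∈ S, ‖x - y‖ ≤ 1)
    (hb : ∀ x ∈ S, ‖f x‖ ≤ M) (h : ∀ x ∈ S, ∀ y ∈ S, ‖f x - f y‖ ≤ M * ‖x - y‖) :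
    HolderBd α S M 0 f := by
  refine ⟨hM, hb, fun x hx y hy => (h x hx y hy).trans ?_⟩
  gcongr
  rcases (norm_nonneg (x - y)).eq_or_lt with h0 | h0
  · rw [← h0]; exact Real.rpow_nonneg le_rfl _
  · simpa using Real.rpow_le_rpow_of_exponent_ge h0 (hS x hx y hy) hα

theorem HolderBd.of_succ {f : E → F} (hα : α ≤ 1) (hS : SmallConvex S)
    (h : HolderBd α S M (k + 1) f) : HolderBd α S M k f := by
  induction k generalizing F with
  | zero => exact .of_lipschitz hα h.nonneg hS.dist_le h.bound (h.lipschitz hS)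
  | succ k ih => exact ⟨h.1, h.2.1, ih h.2.2⟩

theorem HolderBd.of_le {f : E → F} {l : ℕ} (hα : α ≤ 1) (hS : SmallConvex S)
    (h : HolderBd α S M k f) (hl : l ≤ k) : HolderBd α S M l f := by
  induction hl with
  | refl => exact h
  | step _ ih => exact ih (h.of_succ hα hS)

theorem HolderBd.add {f g : E → F} (hS : IsOpen S) (hf : HolderBd α S M k f)
    (hg : HolderBd α S N k g) : HolderBd α S (M + N) k (fun x => f x + g x) := by
  induction k generalizing F with
  | zero =>
    refine ⟨add_nonneg hf.1 hg.1, fun x hx => (norm_add_le _ _).trans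
      (add_le_add (hf.2.1 x hx) (hg.2.1 x hx)), fun x hx y hy => ?_⟩
    rw [add_sub_add_comm, add_mul]
    exact (norm_add_le _ _).trans (add_le_add (hf.2.2 x hx y hy) (hg.2.2 x hx y hy))
  | succ k ih =>
    refine ⟨hf.1.add hg.1, fun x hx => (norm_add_le _ _).trans
      (add_le_add (hf.2.1 x hx) (hg.2.1 x hx)), (ih hf.2.2 hg.2.2).congr hS fun x hx => ?_⟩
    exact (fderiv_fun_add (hf.differentiableAt hS hx) (hg.differentiableAt hS hx)).symm

theorem HolderBd.const (hM : 0 ≤ M) (c : F) (hc : ‖c‖ ≤ M) : HolderBd α S M k (fun _ : E => c) := by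
  induction k generalizing F with
  | zero =>
    refine ⟨hM, fun _ _ => hc, fun x _ y _ => ?_⟩
    rw [sub_self, norm_zero]
    positivity
  | succ k ih =>
    refine ⟨differentiableOn_const c, fun _ _ => hc, ?_⟩
    have : fderiv ℝ (fun _ : E => c) = fun _ => 0 := by funext x; simp
    rw [this]
    exact ih 0 (by simpa using hM)

-- The product rule turns one term into two at each differentiation, as does the Hölder estimate at
-- order zero; hence the factor `2 ^ (k + 1)`. Spaces and bilinear map are generalized in the
-- induction because the derivative involves `B.precompR` and `B.precompL`.
set_option maxSynthPendingDepth 3 in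
theorem HolderBd.bilin (hα : α ≤ 1) (hS : SmallConvex S) (B : F →L[ℝ] G →L[ℝ] H) {f : E → F}
    {g : E → G} (hf : HolderBd α S M k f) (hg : HolderBd α S N k g) :
    HolderBd α S (2 ^ (k + 1) * ‖B‖ * M * N) k (fun x => B (f x) (g x)) := by
  induction k generalizing F G H with
  | zero =>
    have hM := hf.1
    have hN := hg.1
    have hb : ∀ x ∈ S, ‖B (f x) (g x)‖ ≤ ‖B‖ * M * N := fun x hx =>
      (B.le_opNorm₂ _ _).trans (by gcongr; exacts [hf.2.1 x hx, hg.2.1 x hx])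
    have h0 : 0 ≤ ‖B‖ * M * N := by positivity
    refine ⟨by positivity, fun x hx => (hb x hx).trans (by norm_num; linarith), fun x hx y hy => ?_⟩
    have : B (f x) (g x) - B (f y) (g y) = B (f x - f y) (g x) + B (f y) (g x - g y) := by simp
    rw [this]
    have h1 : ‖B (f x - f y) (g x)‖ ≤ ‖B‖ * (M * ‖x - y‖ ^ α) * N :=
      (B.le_opNorm₂ _ _).trans (by gcongr; exacts [hf.2.2 x hx y hy, hg.2.1 x hx])
    have h2 : ‖B (f y) (g x - g y)‖ ≤ ‖B‖ * M * (N * ‖x - y‖ ^ α) :=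
      (B.le_opNorm₂ _ _).trans (by gcongr; exacts [hf.2.1 y hy, hg.2.2 x hx y hy])
    exact ((norm_add_le _ _).trans (add_le_add h1 h2)).trans_eq (by ring)
  | succ k ih =>
    have hM := hf.nonneg
    have hN := hg.nonneg
    refine ⟨fun x hx => ?_, fun x hx => ?_, ?_⟩
    · exact (B.hasFDerivAt_of_bilinear (hf.differentiableAt hS.isOpen hx).hasFDerivAt
        (hg.differentiableAt hS.isOpen hx).hasFDerivAt).differentiableAt.differentiableWithinAt
    · refine (B.le_opNorm₂ _ _).trans ((by gcongr; exacts [hf.bound x hx, hg.bound x hx] :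
        _ ≤ ‖B‖ * M * N).trans ?_)
      have h0 : 0 ≤ ‖B‖ * M * N := by positivity
      have h1 : (1 : ℝ) ≤ 2 ^ (k + 1 + 1) := one_le_pow₀ one_le_two
      nlinarith
    · have h1 := ih (B.precompR E) (hf.of_succ hα hS) hg.2.2
      have h2 := ih (B.precompL E) hf.2.2 (hg.of_succ hα hS)
      refine ((h1.add hS.isOpen h2).mono_const ?_).congr hS.isOpen fun x hx => ?_
      · have e1 : 2 ^ (k + 1) * ‖B.precompR E‖ * M * N ≤ 2 ^ (k + 1) * ‖B‖ * M * N := by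
          gcongr; exact B.norm_precompR_le E
        have e2 : 2 ^ (k + 1) * ‖B.precompL E‖ * M * N ≤ 2 ^ (k + 1) * ‖B‖ * M * N := by
          gcongr; exact B.norm_precompL_le E
        rw [pow_succ 2 (k + 1)]
        linarith
      · exact (B.fderiv_of_bilinear (hf.differentiableAt hS.isOpen hx)
          (hg.differentiableAt hS.isOpen hx)).symm

theorem HolderBd.clm (hα : α ≤ 1) (hS : SmallConvex S) (L : F →L[ℝ] G) {f : E → F}
    (hf : HolderBd α S M k f) : HolderBd α S (2 ^ (k + 1) * ‖L‖ * M) k (fun x => L (f x)) := by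
  refine ((HolderBd.const (norm_nonneg L) L le_rfl).bilin hα hS
    (ContinuousLinearMap.id ℝ (F →L[ℝ] G)) hf).mono_const ?_
  have := hf.nonneg
  have h1 : ‖ContinuousLinearMap.id ℝ (F →L[ℝ] G)‖ ≤ 1 := ContinuousLinearMap.norm_id_le
  calc _ ≤ 2 ^ (k + 1) * 1 * ‖L‖ * M := by gcongr
    _ = _ := by ring

theorem HolderBd.neg {f : E → F} (hS : IsOpen S) (hf : HolderBd α S M k f) :
    HolderBd α S M k (fun x => -f x) := by
  induction k generalizing F with
  | zero =>
    refine ⟨hf.1, fun x hx => by rw [norm_neg]; exact hf.2.1 x hx, fun x hx y hy => ?_⟩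
    rw [← neg_sub', norm_neg]
    exact hf.2.2 x hx y hy
  | succ k ih =>
    refine ⟨hf.1.neg, fun x hx => by rw [norm_neg]; exact hf.2.1 x hx,
      (ih hf.2.2).congr hS fun x _ => ?_⟩
    exact fderiv_fun_neg.symm

theorem HolderBd.smul (hα : α ≤ 1) (hS : SmallConvex S) {f : E → ℝ} {g : E → F}
    (hf : HolderBd α S M k f) (hg : HolderBd α S N k g) :
    HolderBd α S (2 ^ (k + 1) * M * N) k (fun x => f x • g x) := by
  refine (hf.bilin hα hS (ContinuousLinearMap.lsmul ℝ ℝ) hg).mono_const ?_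
  have := hf.nonneg
  have := hg.nonneg
  have h1 : ‖(ContinuousLinearMap.lsmul ℝ ℝ : ℝ →L[ℝ] F →L[ℝ] F)‖ ≤ 1 :=
    ContinuousLinearMap.opNorm_lsmul_le
  calc _ ≤ 2 ^ (k + 1) * 1 * M * N := by gcongr
    _ = _ := by ring

theorem HolderBd.sum {ι : Type} (s : Finset ι) {f : ι → E → F} {M : ι → ℝ} (hS : IsOpen S)
    (hf : ∀ i ∈ s, HolderBd α S (M i) k (f i)) :
    HolderBd α S (∑ i ∈ s, M i) k (fun x => ∑ i ∈ s, f i x) := by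
  classical
  induction s using Finset.induction_on with
  | empty => simpa using HolderBd.const le_rfl (0 : F) (by simp)
  | insert a s ha ih =>
    simp only [Finset.sum_insert ha]
    exact (hf a (by simp)).add hS (ih fun i hi => hf i (by simp [hi]))

/-- Induction through `D(1/f) = -(1/f)² Df`, whose right side involves `1/f` only at the previous
order. -/
theorem HolderBd.exists_inv (hα : α ≤ 1) (hS : SmallConvex S) {f : E → ℝ} {c : ℝ} (hc : 0 < c)
    (hcf : ∀ x ∈ S, c ≤ f x) (hf : HolderBd α S M k f) :
    ∃ N, HolderBd α S N k (fun x => (f x)⁻¹) := by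
  have hb : ∀ x ∈ S, ‖(f x)⁻¹‖ ≤ c⁻¹ := fun x hx => by
    rw [norm_inv, Real.norm_of_nonneg (hc.le.trans (hcf x hx))]
    exact inv_anti₀ hc (hcf x hx)
  have hne : ∀ x ∈ S, f x ≠ 0 := fun x hx => (hc.trans_le (hcf x hx)).ne'
  induction k with
  | zero =>
    refine ⟨max c⁻¹ (c⁻¹ * M * c⁻¹), le_max_of_le_left (by positivity),
      fun x hx => (hb x hx).trans (le_max_left _ _), fun x hx y hy => ?_⟩
    have : (f x)⁻¹ - (f y)⁻¹ = -((f x)⁻¹ * (f x - f y) * (f y)⁻¹) := by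
      field_simp [hne x hx, hne y hy]
      ring
    have hM := hf.1
    rw [this, norm_neg, norm_mul, norm_mul]
    calc _ ≤ c⁻¹ * (M * ‖x - y‖ ^ α) * c⁻¹ := by
          gcongr
          exacts [hb x hx, hf.2.2 x hx y hy, hb y hy]
      _ = c⁻¹ * M * c⁻¹ * ‖x - y‖ ^ α := by ring
      _ ≤ _ := by gcongr; exact le_max_right _ _
  | succ k ih =>
    obtain ⟨N, hN⟩ := ih (hf.of_succ hα hS)
    have h := (((hN.smul hα hS hN).smul hα hS hf.2.2).neg hS.isOpen)
    refine ⟨max c⁻¹ _, fun x hx => ?_, fun x hx => (hb x hx).trans (le_max_left _ _),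
      (h.mono_const (le_max_right _ _)).congr hS.isOpen fun x hx => ?_⟩
    · exact (hf.1 x hx).inv (hne x hx)
    · have := ((hasDerivAt_inv (hne x hx)).comp_hasFDerivAt x
        (hf.differentiableAt hS.isOpen hx).hasFDerivAt).fderiv
      change _ = fderiv ℝ (Inv.inv ∘ f) x
      rw [this]
      ext y
      simp
      left
      ring

-- The constant is chosen before `f` and its codomain. Being uniform in `f` it makes the extension
-- operator bounded, and being uniform in the codomain it lets the induction pass to `fderiv ℝ f`.
set_option maxSynthPendingDepth 3 in
theorem HolderBd.exists_comp (hα0 : 0 < α) (hα : α ≤ 1) {S : Set E'} (hS : SmallConvex S)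
    (hT : IsOpen T) {φ : E' → E}
    (hφ : HolderBd α S N k φ) (hlip : ∀ x ∈ S, ∀ y ∈ S, ‖φ x - φ y‖ ≤ N * ‖x - y‖)
    (hmaps : Set.MapsTo φ S T) :
    ∃ C : ℝ, 0 ≤ C ∧ ∀ {F : Type} [NormedAddCommGroup F] [NormedSpace ℝ F] (f : E → F) (M : ℝ),
      HolderBd α T M k f → HolderBd α S (C * M) k (fun x => f (φ x)) := by
  have hN := hφ.nonneg
  induction k with
  | zero =>
    refine ⟨max 1 (N ^ α), le_max_of_le_left zero_le_one, fun f M hf => ?_⟩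
    have hM := hf.1
    refine ⟨by positivity, fun x hx => (hf.2.1 _ (hmaps hx)).trans
      (le_mul_of_one_le_left hM (le_max_left _ _)), fun x hx y hy => ?_⟩
    refine (hf.2.2 _ (hmaps hx) _ (hmaps hy)).trans ?_
    calc _ ≤ M * (N * ‖x - y‖) ^ α := by
          gcongr
          exact hlip x hx y hy
      _ = N ^ α * M * ‖x - y‖ ^ α := by
          rw [Real.mul_rpow hN (norm_nonneg _)]
          ring
      _ ≤ _ := by
          gcongr
          exact le_max_right _ _
  | succ k ih =>
    obtain ⟨C, hC, h⟩ := ih (hφ.of_succ hα hS)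
    refine ⟨max 1 (2 ^ (k + 1) * C * N), le_max_of_le_left zero_le_one, fun {F} _ _ f M hf => ?_⟩
    have hM := hf.nonneg
    have hd : ∀ x ∈ S, HasFDerivAt (fun x => f (φ x))
        ((fderiv ℝ f (φ x)).comp (fderiv ℝ φ x)) x := fun x hx =>
      (hf.differentiableAt hT (hmaps hx)).hasFDerivAt.comp x
        (hφ.differentiableAt hS.isOpen hx).hasFDerivAt
    refine ⟨fun x hx => (hd x hx).differentiableAt.differentiableWithinAt, fun x hx =>
      (hf.bound _ (hmaps hx)).trans (le_mul_of_one_le_left hM (le_max_left _ _)), ?_⟩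
    have h1 := (h _ _ hf.2.2).bilin hα hS (ContinuousLinearMap.compL ℝ E' E F) hφ.2.2
    refine (h1.mono_const ?_).congr hS.isOpen fun x hx => (hd x hx).fderiv.symm
    have h2 : ‖ContinuousLinearMap.compL ℝ E' E F‖ ≤ 1 := ContinuousLinearMap.norm_compL_le _ _ _ _
    calc _ ≤ 2 ^ (k + 1) * 1 * (C * M) * N := by gcongr
      _ = 2 ^ (k + 1) * C * N * M := by ring
      _ ≤ _ := by
        gcongr
        exact le_max_right _ _

theorem HolderBd.continuousOn {f : E → F} (hα0 : 0 < α) (h : HolderBd α S M k f) :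
    ContinuousOn f S := by
  cases k with
  | succ k => exact h.1.continuousOn
  | zero =>
    intro x hx
    refine tendsto_iff_norm_sub_tendsto_zero.2 (squeeze_zero' (g := fun y => M * ‖y - x‖ ^ α)
      (Filter.Eventually.of_forall fun _ => norm_nonneg _)
      (Filter.eventually_of_mem self_mem_nhdsWithin fun y hy => h.2.2 y hy x hx) ?_)
    have : Continuous fun y : E => M * ‖y - x‖ ^ α :=
      continuous_const.mul ((continuous_id.sub continuous_const).norm.rpow_const
        fun _ => Or.inr hα0.le)
    have h2 := (this.tendsto x).mono_left (nhdsWithin_le_nhds (s := S))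
    simpa [Real.zero_rpow hα0.ne'] using h2

theorem HolderBd.contDiffOn {f : E → F} (hα0 : 0 < α) (hS : IsOpen S) (h : HolderBd α S M k f) :
    ContDiffOn ℝ k f S := by
  induction k generalizing F with
  | zero => exact contDiffOn_zero.2 (h.continuousOn hα0)
  | succ k ih =>
    have := (contDiffOn_succ_iff_fderiv_of_isOpen (n := k) hS).2
      ⟨h.1, fun h => by simp at h, ih h.2.2⟩
    exact_mod_cast this

theorem HolderBd.exists_tendsto [CompleteSpace F] {f : E → F} (hα0 : 0 < α) (hα : α ≤ 1)
    (hS : SmallConvex S)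
    (h : HolderBd α S M k f) {x : E} (hx : x ∈ closure S) : ∃ y, Filter.Tendsto f (𝓝[S] x) (𝓝 y) := by
  have h0 := h.of_le hα hS (Nat.zero_le k)
  have : (𝓝[S] x).NeBot := mem_closure_iff_nhdsWithin_neBot.1 hx
  refine cauchy_map_iff_exists_tendsto.1 (Metric.cauchy_iff.2 ⟨inferInstance, fun ε hε => ?_⟩)
  have hc : Continuous fun p : E × E => M * ‖p.1 - p.2‖ ^ α :=
    continuous_const.mul ((continuous_fst.sub continuous_snd).norm.rpow_const
      fun _ => Or.inr hα0.le)
  have h1 : ∀ᶠ p in 𝓝 (x, x), M * ‖p.1 - p.2‖ ^ α < ε :=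
    hc.continuousAt.eventually_lt continuousAt_const (by simpa [Real.zero_rpow hα0.ne'] using hε)
  rw [nhds_prod_eq] at h1
  obtain ⟨U, hU, hUε⟩ := (Filter.eventually_prod_self_iff
    (r := fun a b => M * ‖a - b‖ ^ α < ε)).1 h1
  refine ⟨f '' (U ∩ S), Filter.image_mem_map (Filter.inter_mem (mem_nhdsWithin_of_mem_nhds hU)
    self_mem_nhdsWithin), ?_⟩
  rintro _ ⟨a, ha, rfl⟩ _ ⟨b, hb, rfl⟩
  rw [dist_eq_norm]
  exact (h0.2.2 a ha.2 b hb.2).trans_lt (hUε a ha.1 b hb.1)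

/-- Only pairs with one point in `K` and the other outside `S` are not covered by the bound on `S`
or by vanishing. They are at least `δ` apart, so the supremum bound gives the Hölder bound with the
factor `(δ ^ α)⁻¹`. This lets a function cut off by a partition of unity be extended by zero. -/
theorem HolderBd.zero_outside {f : E → F} (hα0 : 0 < α) (hS : IsOpen S) {K : Set E} (hK : IsClosed K)
    {δ : ℝ} (hδ : 0 < δ) (hKS : K ⊆ S) (hdist : ∀ x ∈ K, ∀ y ∉ S, δ ≤ ‖x - y‖)
    (hf0 : ∀ x ∉ K, f x = 0) (h : HolderBd α S M k f) :
    HolderBd α Set.univ (max 1 (δ ^ α)⁻¹ * M) k f := by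
  have hM := h.nonneg
  have hle : M ≤ max 1 (δ ^ α)⁻¹ * M := le_mul_of_one_le_left hM (le_max_left _ _)
  have hb : ∀ x ∈ Set.univ, ‖f x‖ ≤ max 1 (δ ^ α)⁻¹ * M := fun x _ => by
    by_cases hx : x ∈ K
    · exact (h.bound x (hKS hx)).trans hle
    · rw [hf0 x hx, norm_zero]
      positivity
  induction k generalizing F with
  | zero =>
    have key : ∀ x ∈ K, ∀ y ∉ S, ‖f x - f y‖ ≤ max 1 (δ ^ α)⁻¹ * M * ‖x - y‖ ^ α := by
      intro x hx y hy
      rw [hf0 y fun h => hy (hKS h), sub_zero]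
      have hp : 0 < δ ^ α := Real.rpow_pos_of_pos hδ _
      have h1 : δ ^ α ≤ ‖x - y‖ ^ α := Real.rpow_le_rpow hδ.le (hdist x hx y hy) hα0.le
      calc ‖f x‖ ≤ M := h.bound x (hKS hx)
        _ = (δ ^ α)⁻¹ * M * δ ^ α := by field_simp
        _ ≤ _ := by
          gcongr
          exact le_max_right _ _
    refine ⟨by positivity, hb, fun x _ y _ => ?_⟩
    by_cases hx : x ∈ K <;> by_cases hy : y ∈ K
    · exact (h.2.2 x (hKS hx) y (hKS hy)).trans (by gcongr)
    · by_cases hy' : y ∈ S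
      · exact (h.2.2 x (hKS hx) y hy').trans (by gcongr)
      · exact key x hx y hy'
    · by_cases hx' : x ∈ S
      · exact (h.2.2 x hx' y (hKS hy)).trans (by gcongr)
      · rw [norm_sub_rev, norm_sub_rev x y]
        exact key y hy x hx'
    · rw [hf0 x hx, hf0 y hy, sub_self, norm_zero]
      positivity
  | succ k ih =>
    have hz : ∀ x ∉ K, fderiv ℝ f x = 0 := fun x hx => by
      have : f =ᶠ[𝓝 x] fun _ => 0 :=
        Filter.eventually_of_mem (hK.isOpen_compl.mem_nhds hx) hf0
      rw [this.fderiv_eq]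
      simp
    refine ⟨fun x _ => ?_, hb, ih hz h.2.2 fun x _ => ?_⟩
    · by_cases hx : x ∈ K
      · exact (h.differentiableAt hS (hKS hx)).differentiableWithinAt
      · have : f =ᶠ[𝓝 x] fun _ => 0 :=
          Filter.eventually_of_mem (hK.isOpen_compl.mem_nhds hx) hf0
        exact (this.differentiableAt_iff.2 (differentiableAt_const _)).differentiableWithinAt
    · by_cases hx : x ∈ K
      · exact (h.2.2.bound x (hKS hx)).trans hle
      · rw [hz x hx, norm_zero]
        positivity

theorem ContDiff.exists_holderBd [FiniteDimensional ℝ E] (hα : α ≤ 1) {f : E → F}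
    (hf : ContDiff ℝ (⊤ : ℕ∞) f)
    (hS : SmallConvex S) (k : ℕ) : ∃ M, HolderBd α S M k f := by
  have hb : ∀ {F : Type} [NormedAddCommGroup F] [NormedSpace ℝ F] (f : E → F), Continuous f →
      ∃ M, 0 ≤ M ∧ ∀ x ∈ S, ‖f x‖ ≤ M := by
    intro F _ _ f hf
    have hSb : Bornology.IsBounded S := by
      refine Metric.isBounded_iff.2 ⟨1, fun x hx y hy => ?_⟩
      rw [dist_eq_norm]
      exact hS.dist_le x hx y hy
    obtain ⟨C, hC⟩ := hSb.isCompact_closure.exists_bound_of_continuousOn hf.continuousOn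
    exact ⟨max C 0, le_max_right _ _, fun x hx => (hC x (subset_closure hx)).trans (le_max_left _ _)⟩
  induction k generalizing F with
  | zero =>
    have h1 := hf.continuous_fderiv (by simp)
    obtain ⟨M, hM0, hM⟩ := hb f hf.continuous
    obtain ⟨N, hN0, hN⟩ := hb _ h1
    refine ⟨max M N, .of_lipschitz hα (le_max_of_le_left hM0) hS.dist_le
      (fun x hx => (hM x hx).trans (le_max_left _ _)) fun x hx y hy => ?_⟩
    exact hS.convex.norm_image_sub_le_of_norm_fderiv_le
      (fun z _ => (hf.differentiable (by simp)).differentiableAt)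
      (fun z hz => (hN z hz).trans (le_max_right _ _)) hy hx
  | succ k ih =>
    obtain ⟨M, _, hM⟩ := hb f hf.continuous
    obtain ⟨N, hN⟩ := ih (f := fderiv ℝ f) (hf.fderiv_right (by simp))
    exact ⟨max M N, (hf.differentiable (by simp)).differentiableOn,
      fun x hx => (hM x hx).trans (le_max_left _ _), hN.mono_const (le_max_right _ _)⟩

/-- Connects the recursive form, suited to induction with the chain and product rules, with the
iterated derivatives in which the theorem is phrased. -/
theorem holderBd_iff_iteratedFDeriv {f : E → F} (hα0 : 0 < α) (hS : IsOpen S) (hM : 0 ≤ M) :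
    HolderBd α S M k f ↔ ContDiffOn ℝ k f S ∧ (∀ j ≤ k, ∀ x ∈ S, ‖iteratedFDeriv ℝ j f x‖ ≤ M) ∧
      ∀ x ∈ S, ∀ y ∈ S, ‖iteratedFDeriv ℝ k f x - iteratedFDeriv ℝ k f y‖ ≤ M * ‖x - y‖ ^ α := by
  induction k generalizing F with
  | zero =>
    have hsub : ∀ x y, ‖iteratedFDeriv ℝ 0 f x - iteratedFDeriv ℝ 0 f y‖ = ‖f x - f y‖ := by
      intro x y
      rw [iteratedFDeriv_zero_eq_comp, Function.comp_apply, Function.comp_apply, ← map_sub,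
        LinearIsometryEquiv.norm_map]
    constructor
    · intro h
      refine ⟨h.contDiffOn hα0 hS, fun j hj x hx => ?_, fun x hx y hy => ?_⟩
      · obtain rfl : j = 0 := by omega
        rw [norm_iteratedFDeriv_zero]
        exact h.bound x hx
      · rw [hsub]
        exact h.2.2 x hx y hy
    · rintro ⟨_, h1, h2⟩
      refine ⟨hM, fun x hx => ?_, fun x hx y hy => ?_⟩
      · rw [← norm_iteratedFDeriv_zero (𝕜 := ℝ)]
        exact h1 0 le_rfl x hx
      · rw [← hsub]
        exact h2 x hx y hy
  | succ k ih =>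
    have hsub : ∀ x y, ‖iteratedFDeriv ℝ (k + 1) f x - iteratedFDeriv ℝ (k + 1) f y‖ =
        ‖iteratedFDeriv ℝ k (fderiv ℝ f) x - iteratedFDeriv ℝ k (fderiv ℝ f) y‖ := by
      intro x y
      rw [iteratedFDeriv_succ_eq_comp_right, iteratedFDeriv_succ_eq_comp_right, ← dist_eq_norm,
        ← dist_eq_norm]
      exact LinearIsometryEquiv.dist_map _ _ _
    have hcd := contDiffOn_succ_iff_fderiv_of_isOpen (𝕜 := ℝ) (n := k) (f := f) hS
    constructor
    · intro h
      obtain ⟨h1, h2, h3⟩ := ih.1 h.2.2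
      refine ⟨h.contDiffOn hα0 hS, fun j hj x hx => ?_, fun x hx y hy => ?_⟩
      · cases j with
        | zero => rw [norm_iteratedFDeriv_zero]; exact h.bound x hx
        | succ j => rw [← norm_iteratedFDeriv_fderiv]; exact h2 j (by omega) x hx
      · rw [hsub]
        exact h3 x hx y hy
    · rintro ⟨h0, h1, h2⟩
      obtain ⟨h3, -, h4⟩ := hcd.1 (by exact_mod_cast h0)
      refine ⟨h3, fun x hx => ?_, ih.2 ⟨h4, fun j hj x hx => ?_, fun x hx y hy => ?_⟩⟩
      · rw [← norm_iteratedFDeriv_zero (𝕜 := ℝ)]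
        exact h1 0 (by omega) x hx
      · rw [norm_iteratedFDeriv_fderiv]
        exact h1 (j + 1) (by omega) x hx
      · rw [← hsub]
        exact h2 x hx y hy

end HolderCalculus

theorem Filter.Tendsto.continuousLinearMap_apply {ι E F : Type} [NormedAddCommGroup E] [NormedSpace ℝ E]
    [NormedAddCommGroup F] [NormedSpace ℝ F] {l : Filter ι} {A : ι → E →L[ℝ] F} {x : ι → E}
    {A₀ : E →L[ℝ] F} {x₀ : E} (hA : Filter.Tendsto A l (𝓝 A₀)) (hx : Filter.Tendsto x l (𝓝 x₀)) :
    Filter.Tendsto (fun i => A i (x i)) l (𝓝 (A₀ x₀)) :=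
  ((isBoundedBilinearMap_apply (𝕜 := ℝ) (E := E) (F := F)).continuous.tendsto (A₀, x₀)).comp
    (hA.prodMk_nhds hx)

/-! ### Boundary limits of functions and their first two derivatives. -/

section Jets

variable {E E' F G : Type} [NormedAddCommGroup E] [NormedSpace ℝ E] [NormedAddCommGroup E']
  [NormedSpace ℝ E'] [NormedAddCommGroup F] [NormedSpace ℝ F] [NormedAddCommGroup G]
  [NormedSpace ℝ G] {S : Set E} {T : Set E'}

/-- `f` is twice continuously differentiable on `S`, and it and its first two derivatives converge
to `f₀`, `f₁`, `f₂` at the point `z` along `S`. -/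
structure JetTendsto (S : Set E) (z : E) (f : E → F) (f₀ : F) (f₁ : E →L[ℝ] F)
    (f₂ : E →L[ℝ] E →L[ℝ] F) : Prop where
  contDiffOn : ContDiffOn ℝ 2 f S
  tendsto : Filter.Tendsto f (𝓝[S] z) (𝓝 f₀)
  tendsto_fderiv : Filter.Tendsto (fderiv ℝ f) (𝓝[S] z) (𝓝 f₁)
  tendsto_fderiv_fderiv : Filter.Tendsto (fderiv ℝ (fderiv ℝ f)) (𝓝[S] z) (𝓝 f₂)

theorem ContDiffOn.differentiableAt_fderiv {f : E → F} (h : ContDiffOn ℝ 2 f S) (hS : IsOpen S)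
    {x : E} (hx : x ∈ S) : DifferentiableAt ℝ f x ∧ DifferentiableAt ℝ (fderiv ℝ f) x := by
  have h1 := h.contDiffAt (hS.mem_nhds hx)
  exact ⟨h1.differentiableAt (by simp),
    (h1.fderiv_right (m := 1) (by norm_num)).differentiableAt (by simp)⟩

theorem JetTendsto.mono {z : E} {f : E → F} {f₀ f₁ f₂} (h : JetTendsto S z f f₀ f₁ f₂)
    {S' : Set E} (hS : S' ⊆ S) : JetTendsto S' z f f₀ f₁ f₂ :=
  ⟨h.1.mono hS, h.2.mono_left (nhdsWithin_mono _ hS), h.3.mono_left (nhdsWithin_mono _ hS),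
    h.4.mono_left (nhdsWithin_mono _ hS)⟩

theorem JetTendsto.congr {z : E} {f g : E → F} {f₀ f₁ f₂} (h : JetTendsto S z f f₀ f₁ f₂)
    (hS : IsOpen S) (hfg : Set.EqOn f g S) : JetTendsto S z g f₀ f₁ f₂ := by
  have h1 : Set.EqOn (fderiv ℝ f) (fderiv ℝ g) S := fun x hx =>
    (Filter.eventuallyEq_of_mem (hS.mem_nhds hx) hfg).fderiv_eq
  have h2 : Set.EqOn (fderiv ℝ (fderiv ℝ f)) (fderiv ℝ (fderiv ℝ g)) S := fun x hx =>
    (Filter.eventuallyEq_of_mem (hS.mem_nhds hx) h1).fderiv_eq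
  exact ⟨h.1.congr fun x hx => (hfg hx).symm, h.2.congr' (Filter.eventuallyEq_of_mem
    self_mem_nhdsWithin hfg), h.3.congr' (Filter.eventuallyEq_of_mem self_mem_nhdsWithin h1),
    h.4.congr' (Filter.eventuallyEq_of_mem self_mem_nhdsWithin h2)⟩

theorem JetTendsto.add {z : E} {f g : E → F} {f₀ f₁ f₂ g₀ g₁ g₂} (hS : IsOpen S)
    (hf : JetTendsto S z f f₀ f₁ f₂) (hg : JetTendsto S z g g₀ g₁ g₂) :
    JetTendsto S z (fun x => f x + g x) (f₀ + g₀) (f₁ + g₁) (f₂ + g₂) := by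
  have h1 : Set.EqOn (fun x => fderiv ℝ f x + fderiv ℝ g x) (fderiv ℝ fun x => f x + g x) S :=
    fun x hx => (fderiv_fun_add (hf.1.differentiableAt_fderiv hS hx).1
      (hg.1.differentiableAt_fderiv hS hx).1).symm
  have h2 : Set.EqOn (fun x => fderiv ℝ (fderiv ℝ f) x + fderiv ℝ (fderiv ℝ g) x)
      (fderiv ℝ (fderiv ℝ fun x => f x + g x)) S := fun x hx => by
    rw [← (Filter.eventuallyEq_of_mem (hS.mem_nhds hx) h1).fderiv_eq]
    exact (fderiv_fun_add (hf.1.differentiableAt_fderiv hS hx).2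
      (hg.1.differentiableAt_fderiv hS hx).2).symm
  exact ⟨hf.1.add hg.1, hf.2.add hg.2, (hf.3.add hg.3).congr' (Filter.eventuallyEq_of_mem
    self_mem_nhdsWithin h1), (hf.4.add hg.4).congr' (Filter.eventuallyEq_of_mem
    self_mem_nhdsWithin h2)⟩

theorem JetTendsto.neg {z : E} {f : E → F} {f₀ f₁ f₂} (h : JetTendsto S z f f₀ f₁ f₂) :
    JetTendsto S z (fun x => -f x) (-f₀) (-f₁) (-f₂) := by
  have h1 : (fderiv ℝ fun x => -f x) = fun x => -fderiv ℝ f x := funext fun _ => fderiv_fun_neg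
  have h2 : (fderiv ℝ (fderiv ℝ fun x => -f x)) = fun x => -fderiv ℝ (fderiv ℝ f) x := by
    rw [h1]; exact funext fun _ => fderiv_fun_neg
  exact ⟨h.1.neg, h.2.neg, by rw [h1]; exact h.3.neg, by rw [h2]; exact h.4.neg⟩

theorem ContinuousLinearMap.jetTendsto (L : E →L[ℝ] F) (z : E) : JetTendsto S z L (L z) L 0 := by
  have h1 : fderiv ℝ L = fun _ => L := funext fun _ => L.fderiv
  have h2 : fderiv ℝ (fderiv ℝ L) = fun _ => 0 := by rw [h1]; funext x; simp
  exact ⟨L.contDiff.contDiffOn, (L.continuous.tendsto z).mono_left nhdsWithin_le_nhds,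
    by rw [h1]; exact tendsto_const_nhds, by rw [h2]; exact tendsto_const_nhds⟩

/-- The undifferentiated factor `τ` tends to zero at `z`, so the product rule leaves only the terms
in which `τ` is differentiated once: the second derivative is `τ(x) f₁ y + τ(y) f₁ x`. -/
theorem JetTendsto.smul_clm {z : E} {f : E → F} {f₀ f₁ f₂} (h : JetTendsto S z f f₀ f₁ f₂)
    (hS : IsOpen S) (τ : E →L[ℝ] ℝ) (hτ : τ z = 0) :
    JetTendsto S z (fun x => τ x • f x) 0 (ContinuousLinearMap.smulRightL ℝ E F τ f₀)
      (ContinuousLinearMap.smulRightL ℝ E (E →L[ℝ] F) τ f₁ +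
        (ContinuousLinearMap.smulRightL ℝ E F τ).comp f₁) := by
  have ht : Filter.Tendsto τ (𝓝[S] z) (𝓝 0) := by
    rw [← hτ]; exact (τ.continuous.tendsto z).mono_left nhdsWithin_le_nhds
  have key : ∀ {F : Type} [NormedAddCommGroup F] [NormedSpace ℝ F] {f : E → F} {x : E},
      DifferentiableAt ℝ f x → HasFDerivAt (fun x => τ x • f x)
        (τ x • fderiv ℝ f x + ContinuousLinearMap.smulRightL ℝ E F τ (f x)) x :=
    fun h => τ.hasFDerivAt.smul h.hasFDerivAt
  have h1 : Set.EqOn (fun x => τ x • fderiv ℝ f x + ContinuousLinearMap.smulRightL ℝ E F τ (f x))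
      (fderiv ℝ fun x => τ x • f x) S :=
    fun x hx => (key (h.1.differentiableAt_fderiv hS hx).1).fderiv.symm
  have h2 : Set.EqOn (fun x => τ x • fderiv ℝ (fderiv ℝ f) x +
      ContinuousLinearMap.smulRightL ℝ E (E →L[ℝ] F) τ (fderiv ℝ f x) +
        (ContinuousLinearMap.smulRightL ℝ E F τ).comp (fderiv ℝ f x))
      (fderiv ℝ (fderiv ℝ fun x => τ x • f x)) S := fun x hx => by
    rw [← (Filter.eventuallyEq_of_mem (hS.mem_nhds hx) h1).fderiv_eq]
    have ha := h.1.differentiableAt_fderiv hS hx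
    exact ((key ha.2).add ((ContinuousLinearMap.smulRightL ℝ E F τ).hasFDerivAt.comp x
      ha.1.hasFDerivAt)).fderiv.symm
  refine ⟨τ.contDiff.contDiffOn.smul h.1, by simpa using ht.smul h.2,
    Filter.Tendsto.congr' (Filter.eventuallyEq_of_mem self_mem_nhdsWithin h1) ?_,
    Filter.Tendsto.congr' (Filter.eventuallyEq_of_mem self_mem_nhdsWithin h2) ?_⟩
  · simpa using (ht.smul h.3).add
      (((ContinuousLinearMap.smulRightL ℝ E F τ).continuous.tendsto f₀).comp h.2)
  · have h5 : Continuous fun L : E →L[ℝ] F =>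
        ContinuousLinearMap.smulRightL ℝ E (E →L[ℝ] F) τ L +
          (ContinuousLinearMap.smulRightL ℝ E F τ).comp L := by fun_prop
    simpa [add_assoc] using (ht.smul h.4).add ((h5.tendsto f₁).comp h.3)

set_option maxSynthPendingDepth 3 in
theorem JetTendsto.comp {z : E} {φ : E → E'} {φ₀ φ₁ φ₂} {g : E' → F} {g₀ g₁ g₂}
    (hS : IsOpen S) (hT : IsOpen T) (hg : JetTendsto T φ₀ g g₀ g₁ g₂)
    (hφ : JetTendsto S z φ φ₀ φ₁ φ₂) (hmaps : Set.MapsTo φ S T) :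
    ∃ f₂, (∀ x y, f₂ x y = g₂ (φ₁ x) (φ₁ y) + g₁ (φ₂ x y)) ∧
      JetTendsto S z (fun x => g (φ x)) g₀ (g₁.comp φ₁) f₂ := by
  have ht : Filter.Tendsto φ (𝓝[S] z) (𝓝[T] φ₀) :=
    tendsto_nhdsWithin_iff.2 ⟨hφ.2, Filter.eventually_of_mem self_mem_nhdsWithin hmaps⟩
  let B := ContinuousLinearMap.compL ℝ E E' F
  have h1 : Set.EqOn (fun x => B (fderiv ℝ g (φ x)) (fderiv ℝ φ x))
      (fderiv ℝ fun x => g (φ x)) S := fun x hx =>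
    ((hg.1.differentiableAt_fderiv hT (hmaps hx)).1.hasFDerivAt.comp x
      (hφ.1.differentiableAt_fderiv hS hx).1.hasFDerivAt).fderiv.symm
  have h2 : Set.EqOn (fun x => B.precompR E (fderiv ℝ g (φ x)) (fderiv ℝ (fderiv ℝ φ) x) +
      B.precompL E ((fderiv ℝ (fderiv ℝ g) (φ x)).comp (fderiv ℝ φ x)) (fderiv ℝ φ x))
      (fderiv ℝ (fderiv ℝ fun x => g (φ x))) S := fun x hx => by
    rw [← (Filter.eventuallyEq_of_mem (hS.mem_nhds hx) h1).fderiv_eq]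
    have ha := hg.1.differentiableAt_fderiv hT (hmaps hx)
    have hb := hφ.1.differentiableAt_fderiv hS hx
    exact (B.hasFDerivAt_of_bilinear (ha.2.hasFDerivAt.comp x hb.1.hasFDerivAt)
      hb.2.hasFDerivAt).fderiv.symm
  refine ⟨B.precompR E g₁ φ₂ + B.precompL E (g₂.comp φ₁) φ₁, fun x y => ?_,
    hg.1.comp hφ.1 hmaps, hg.2.comp ht,
    Filter.Tendsto.congr' (Filter.eventuallyEq_of_mem self_mem_nhdsWithin h1) ?_,
    Filter.Tendsto.congr' (Filter.eventuallyEq_of_mem self_mem_nhdsWithin h2) ?_⟩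
  · simp [B, add_comm]
  · exact ((B.continuous.tendsto g₁).comp (hg.3.comp ht)).continuousLinearMap_apply hφ.3
  · have h3 := ((B.precompR E).continuous.tendsto g₁).comp (hg.3.comp ht)
    have h4 := ((B.precompL E).continuous.tendsto _).comp 
      ((((ContinuousLinearMap.compL ℝ E E' (E' →L[ℝ] F)).continuous.tendsto g₂).comp
        (hg.4.comp ht)).continuousLinearMap_apply hφ.3)
    exact (h3.continuousLinearMap_apply hφ.4).add (h4.continuousLinearMap_apply hφ.3)

theorem HolderBd.exists_jetTendsto [CompleteSpace F] {α M : ℝ} {f : E → F} (hα0 : 0 < α)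
    (hα : α ≤ 1) (hS : SmallConvex S) (h : HolderBd α S M 2 f) {z : E} (hz : z ∈ closure S) :
    ∃ f₀ f₁ f₂, JetTendsto S z f f₀ f₁ f₂ := by
  obtain ⟨f₀, h0⟩ := h.exists_tendsto hα0 hα hS hz
  obtain ⟨f₁, h1⟩ := h.2.2.exists_tendsto hα0 hα hS hz
  obtain ⟨f₂, h2⟩ := h.2.2.2.2.exists_tendsto hα0 hα hS hz
  exact ⟨f₀, f₁, f₂, h.contDiffOn hα0 hS.isOpen, h0, h1, h2⟩

theorem JetTendsto.symm {z : E} {f : E → F} {f₀ f₁ f₂} (h : JetTendsto S z f f₀ f₁ f₂)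
    (hS : IsOpen S) (hz : z ∈ closure S) (x y : E) : f₂ x y = f₂ y x := by
  have : (𝓝[S] z).NeBot := mem_closure_iff_nhdsWithin_neBot.1 hz
  have h1 : ∀ x y : E, Filter.Tendsto (fun w => fderiv ℝ (fderiv ℝ f) w x y) (𝓝[S] z)
      (𝓝 (f₂ x y)) := fun x y =>
    (h.4.continuousLinearMap_apply tendsto_const_nhds).continuousLinearMap_apply tendsto_const_nhds
  refine tendsto_nhds_unique (h1 x y) ((h1 y x).congr' ?_)
  filter_upwards [self_mem_nhdsWithin] with w hw
  exact ((h.1.contDiffAt (hS.mem_nhds hw)).isSymmSndFDerivAt (by simp)) y x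

end Jets

/-! ### Differentiation up to a hyperplane and gluing across it. -/

section HalfSpace

variable {E F : Type} [NormedAddCommGroup E] [NormedSpace ℝ E] [NormedAddCommGroup F]
  [NormedSpace ℝ F] {τ : E →L[ℝ] ℝ} {e : E} {U : Set E}

theorem mem_closure_inter_halfSpace (he : τ e = 1) (hU : IsOpen U) {z : E} (hz : z ∈ U)
    (hτ : 0 ≤ τ z) : z ∈ closure (U ∩ {z | 0 < τ z}) := by
  have h1 : Filter.Tendsto (fun h : ℝ => z + h • e) (𝓝[>] 0) (𝓝 z) := by
    have : Continuous fun h : ℝ => z + h • e := by fun_prop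
    simpa using (this.tendsto 0).mono_left nhdsWithin_le_nhds
  refine mem_closure_of_tendsto h1 ?_
  filter_upwards [h1.eventually (hU.mem_nhds hz), self_mem_nhdsWithin] with h hh h0
  have h0' : 0 < h := h0
  exact ⟨hh, by simp [he]; linarith⟩

theorem isOpen_halfSpace (τ : E →L[ℝ] ℝ) : IsOpen {z | 0 < τ z} :=
  isOpen_lt continuous_const τ.continuous

theorem convex_halfSpace (τ : E →L[ℝ] ℝ) : Convex ℝ {z | 0 < τ z} :=
  convex_halfSpace_gt τ.isLinear 0

theorem smallConvex_ball {z : E} {r : ℝ} (hr : r ≤ 1 / 2) : SmallConvex (Metric.ball z r) := by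
  refine ⟨Metric.isOpen_ball, convex_ball _ _, fun x hx y hy => ?_⟩
  rw [← dist_eq_norm]
  have h1 := Metric.mem_ball.1 hx
  have h2 := Metric.mem_ball'.1 hy
  linarith [dist_triangle x z y]

theorem SmallConvex.inter_halfSpace {S : Set E} (hS : SmallConvex S) (τ : E →L[ℝ] ℝ) :
    SmallConvex (S ∩ {z | 0 < τ z}) :=
  ⟨hS.isOpen.inter (isOpen_halfSpace τ), hS.convex.inter (convex_halfSpace τ),
    fun x hx y hy => hS.dist_le x hx.1 y hy.1⟩

/-- A limit of the derivative at a boundary point of a convex open set is a one-sided derivative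
there. Intersecting with a small ball supplies the convexity that `U` may lack. -/
theorem hasFDerivWithinAt_halfSpace (he : τ e = 1) (hU : IsOpen U) {f : E → F} {z : E} (hz : z ∈ U)
    (hτ : τ z = 0) (hd : DifferentiableOn ℝ f (U ∩ {z | 0 < τ z}))
    (hc : ∀ y ∈ U, 0 ≤ τ y → ContinuousWithinAt f {z | 0 < τ z} y) {L : E →L[ℝ] F}
    (hL : Filter.Tendsto (fderiv ℝ f) (𝓝[U ∩ {z | 0 < τ z}] z) (𝓝 L)) :
    HasFDerivWithinAt f L {z | 0 ≤ τ z} z := by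
  obtain ⟨ε, hε, hεU⟩ := Metric.nhds_basis_closedBall.mem_iff.1 (hU.mem_nhds hz)
  have hsub : Metric.ball z ε ∩ {z | 0 < τ z} ⊆ U ∩ {z | 0 < τ z} :=
    Set.inter_subset_inter_left _ (Metric.ball_subset_closedBall.trans hεU)
  have h := hasFDerivWithinAt_closure_of_tendsto_fderiv (hd.mono hsub)
    ((convex_ball z ε).inter (convex_halfSpace τ))
    (Metric.isOpen_ball.inter (isOpen_halfSpace τ)) (fun y hy => ?_)
    (hL.mono_left (nhdsWithin_mono _ hsub))
  · refine h.mono_of_mem_nhdsWithin ?_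
    filter_upwards [self_mem_nhdsWithin, mem_nhdsWithin_of_mem_nhds (Metric.ball_mem_nhds z hε)]
      with y hy hy'
    exact mem_closure_inter_halfSpace he Metric.isOpen_ball hy' hy
  · have h1 := closure_inter_subset_inter_closure _ _ hy
    refine (hc y (hεU (Metric.closure_ball_subset_closedBall h1.1)) ?_).mono
      Set.inter_subset_right
    exact closure_minimal (fun z (hz : 0 < τ z) => hz.le)
      (isClosed_le continuous_const τ.continuous) h1.2

theorem fderiv_tangential_eq_zero (he : τ e = 1) (hU : IsOpen U) {f : E → F} {z : E} (hz : z ∈ U)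
    (hτ : τ z = 0) (hd : DifferentiableOn ℝ f (U ∩ {z | 0 < τ z}))
    (hc : ∀ y ∈ U, τ y = 0 → Filter.Tendsto f (𝓝[U ∩ {z | 0 < τ z}] y) (𝓝 0)) {L : E →L[ℝ] F}
    (hL : Filter.Tendsto (fderiv ℝ f) (𝓝[U ∩ {z | 0 < τ z}] z) (𝓝 L)) {x : E} (hx : τ x = 0) :
    L x = 0 := by
  classical
  have hopen := hU.inter (isOpen_halfSpace τ)
  -- Giving `f` the value zero on the hyperplane makes it one-sidedly differentiable there with
  -- derivative `L`. It is constant along lines in the hyperplane, so `L` kills tangential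
  -- directions.
  let g : E → F := fun y => if 0 < τ y then f y else 0
  have hfg : Set.EqOn f g (U ∩ {z | 0 < τ z}) := fun y hy => (if_pos hy.2).symm
  have h := hasFDerivWithinAt_halfSpace (f := g) (L := L) he hU hz hτ
    (hd.congr fun y hy => (hfg hy).symm) (fun y hy hy' => ?_) ?_
  · have hline : HasDerivAt (fun h : ℝ => z + h • x) x 0 := by
      simpa using ((hasDerivAt_id (0 : ℝ)).smul_const x).const_add z
    have h1 := HasFDerivWithinAt.comp_hasDerivWithinAt (l := g) (l' := L) (s := Set.univ)
      (t := {z | 0 ≤ τ z}) (f := fun h : ℝ => z + h • x) (0 : ℝ) (by simpa using h)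
      hline.hasDerivWithinAt (fun h _ => by simp [hτ, hx])
    have h2 : g ∘ (fun h : ℝ => z + h • x) = fun _ => 0 := by
      funext h
      simp [g, hτ, hx]
    rw [h2, hasDerivWithinAt_univ] at h1
    exact h1.unique (hasDerivAt_const _ _)
  · rcases hy'.eq_or_lt with h0 | h0
    · have : g y = 0 := if_neg (by simp [← h0])
      rw [ContinuousWithinAt, this]
      have h3 := (hc y hy h0.symm).congr' (Filter.eventuallyEq_of_mem self_mem_nhdsWithin hfg)
      rwa [nhdsWithin_inter_of_mem (mem_nhdsWithin_of_mem_nhds (hU.mem_nhds hy))] at h3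
    · exact (((hd y ⟨hy, h0⟩).differentiableAt (hopen.mem_nhds ⟨hy, h0⟩)).continuousAt.congr
        (Filter.eventuallyEq_of_mem (hopen.mem_nhds ⟨hy, h0⟩) hfg)).continuousWithinAt
  · refine hL.congr' ?_
    filter_upwards [self_mem_nhdsWithin] with y hy
    exact (Filter.eventuallyEq_of_mem (hopen.mem_nhds hy) hfg).fderiv_eq

/-- A continuous function that is continuously differentiable off a hyperplane is continuously
differentiable if its derivative has equal limits from both sides. -/
theorem differentiableOn_of_halfSpaces (he : τ e = 1) (hU : IsOpen U) {f : E → F}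
    (hc : ContinuousOn f U)
    (hd : DifferentiableOn ℝ f (U ∩ {z | 0 < τ z}))
    (hd' : DifferentiableOn ℝ f (U ∩ {z | 0 < (-τ) z}))
    (hcd : ContinuousOn (fderiv ℝ f) (U ∩ {z | 0 < τ z}))
    (hcd' : ContinuousOn (fderiv ℝ f) (U ∩ {z | 0 < (-τ) z}))
    (hL : ∀ z ∈ U, τ z = 0 → ∃ L, Filter.Tendsto (fderiv ℝ f) (𝓝[U ∩ {z | 0 < τ z}] z) (𝓝 L) ∧
      Filter.Tendsto (fderiv ℝ f) (𝓝[U ∩ {z | 0 < (-τ) z}] z) (𝓝 L)) :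
    DifferentiableOn ℝ f U ∧ ContinuousOn (fderiv ℝ f) U := by
  have ho := hU.inter (isOpen_halfSpace τ)
  have ho' := hU.inter (isOpen_halfSpace (-τ))
  have key : ∀ z ∈ U, τ z = 0 → ∀ L, Filter.Tendsto (fderiv ℝ f) (𝓝[U ∩ {z | 0 < τ z}] z) (𝓝 L) →
      Filter.Tendsto (fderiv ℝ f) (𝓝[U ∩ {z | 0 < (-τ) z}] z) (𝓝 L) → HasFDerivAt f L z := by
    intro z hz hτ L h1 h2
    have h3 := hasFDerivWithinAt_halfSpace he hU hz hτ hd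
      (fun y hy _ => (hc.continuousAt (hU.mem_nhds hy)).continuousWithinAt) h1
    have h4 := hasFDerivWithinAt_halfSpace (τ := -τ) (e := -e) (by simpa using he) hU hz
      (by simpa using hτ) hd'
      (fun y hy _ => (hc.continuousAt (hU.mem_nhds hy)).continuousWithinAt) h2
    have h5 := h3.union h4
    rwa [show {z | 0 ≤ τ z} ∪ {z | 0 ≤ (-τ) z} = Set.univ from
      Set.eq_univ_of_forall fun z => by simpa using le_total 0 (τ z), hasFDerivWithinAt_univ] at h5
  refine ⟨fun z hz => ?_, fun z hz => ?_⟩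
  · rcases lt_trichotomy (τ z) 0 with h | h | h
    · have : z ∈ U ∩ {z | 0 < (-τ) z} := ⟨hz, by simpa using h⟩
      exact ((hd' z this).differentiableAt (ho'.mem_nhds this)).differentiableWithinAt
    · obtain ⟨L, h1, h2⟩ := hL z hz h
      exact (key z hz h L h1 h2).differentiableAt.differentiableWithinAt
    · have : z ∈ U ∩ {z | 0 < τ z} := ⟨hz, h⟩
      exact ((hd z this).differentiableAt (ho.mem_nhds this)).differentiableWithinAt
  · refine ContinuousAt.continuousWithinAt ?_
    rcases lt_trichotomy (τ z) 0 with h | h | h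
    · have : z ∈ U ∩ {z | 0 < (-τ) z} := ⟨hz, by simpa using h⟩
      exact hcd'.continuousAt (ho'.mem_nhds this)
    · obtain ⟨L, h1, h2⟩ := hL z hz h
      rw [ContinuousAt, (key z hz h L h1 h2).fderiv]
      -- on the hyperplane the derivative is itself a limit of values off the hyperplane
      rw [(Metric.nhds_basis_closedBall (x := L)).tendsto_right_iff]
      intro ε hε
      have h1' := h1.eventually (Metric.closedBall_mem_nhds L hε)
      have h2' := h2.eventually (Metric.closedBall_mem_nhds L hε)
      rw [eventually_nhdsWithin_iff] at h1' h2'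
      filter_upwards [eventually_eventually_nhds.2 h1', h2', hU.mem_nhds hz] with y hy1 hy2 hyU
      rcases lt_trichotomy (τ y) 0 with hy | hy | hy
      · exact hy2 ⟨hyU, by simpa using hy⟩
      · obtain ⟨L', h3, h4⟩ := hL y hyU hy
        rw [(key y hyU hy L' h3 h4).fderiv]
        have : (𝓝[U ∩ {z | 0 < τ z}] y).NeBot :=
          mem_closure_iff_nhdsWithin_neBot.1 (mem_closure_inter_halfSpace he hU hyU hy.ge)
        exact Metric.isClosed_closedBall.mem_of_tendsto h3 (eventually_nhdsWithin_iff.2 hy1)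
      · exact hy1.self_of_nhds ⟨hyU, hy⟩
    · have : z ∈ U ∩ {z | 0 < τ z} := ⟨hz, h⟩
      exact hcd.continuousAt (ho.mem_nhds this)

/-- By continuity the bounds on each open half extend to the hyperplane. Two points on opposite
sides are compared through the point where their segment crosses it, which gives the factor two. -/
theorem HolderBd.glue_zero {α M : ℝ} (hα0 : 0 < α) (he : τ e = 1) (hU : IsOpen U)
    (hUc : Convex ℝ U) {f : E → F} (hc : ContinuousOn f U)
    (h : HolderBd α (U ∩ {z | 0 < τ z}) M 0 f) (h' : HolderBd α (U ∩ {z | 0 < (-τ) z}) M 0 f) :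
    HolderBd α U (2 * M) 0 f := by
  have hM := h.1
  have hcont : Continuous fun p : E × E => M * ‖p.1 - p.2‖ ^ α :=
    continuous_const.mul ((continuous_fst.sub continuous_snd).norm.rpow_const
      fun _ => Or.inr hα0.le)
  have clos : ∀ (σ : E →L[ℝ] ℝ) (d : E), σ d = 1 → HolderBd α (U ∩ {z | 0 < σ z}) M 0 f →
      ∀ x ∈ U, 0 ≤ σ x → ‖f x‖ ≤ M ∧
        ∀ y ∈ U, 0 ≤ σ y → ‖f x - f y‖ ≤ M * ‖x - y‖ ^ α := by
    intro σ d hd hσ x hx hx0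
    have hne : ∀ x ∈ U, 0 ≤ σ x → (𝓝[U ∩ {z | 0 < σ z}] x).NeBot := fun x hx hx0 =>
      mem_closure_iff_nhdsWithin_neBot.1 (mem_closure_inter_halfSpace hd hU hx hx0)
    have ht : ∀ x ∈ U, Filter.Tendsto f (𝓝[U ∩ {z | 0 < σ z}] x) (𝓝 (f x)) := fun x hx =>
      (hc.continuousAt (hU.mem_nhds hx)).tendsto.mono_left nhdsWithin_le_nhds
    have := hne x hx hx0
    refine ⟨le_of_tendsto (ht x hx).norm
      (Filter.eventually_of_mem self_mem_nhdsWithin hσ.2.1), fun y hy hy0 => ?_⟩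
    have := hne y hy hy0
    refine le_of_tendsto_of_tendsto
      (b := 𝓝[U ∩ {z | 0 < σ z}] x ×ˢ 𝓝[U ∩ {z | 0 < σ z}] y)
      (f := fun p : E × E => ‖f p.1 - f p.2‖) (g := fun p : E × E => M * ‖p.1 - p.2‖ ^ α)
      (((ht x hx).comp Filter.tendsto_fst).sub ((ht y hy).comp Filter.tendsto_snd)).norm
      ((hcont.tendsto (x, y)).mono_left ?_) ?_
    · rw [nhds_prod_eq]
      exact Filter.prod_mono nhdsWithin_le_nhds nhdsWithin_le_nhds
    · filter_upwards [Filter.prod_mem_prod (self_mem_nhdsWithin (a := x))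
        (self_mem_nhdsWithin (a := y))] with p hp
      exact hσ.2.2 _ hp.1 _ hp.2
  have hp := clos τ e he h
  have hm := clos (-τ) (-e) (by simpa using he) h'
  have cross : ∀ x ∈ U, ∀ y ∈ U, 0 ≤ τ x → τ y ≤ 0 → ‖f x - f y‖ ≤ 2 * M * ‖x - y‖ ^ α := by
    intro x hx y hy hx0 hy0
    obtain ⟨w, hw, hw0⟩ : ∃ w ∈ segment ℝ x y, τ w = 0 := by
      have := (convex_segment x y).isPreconnected.intermediate_value
        (right_mem_segment ℝ x y) (left_mem_segment ℝ x y) τ.continuous.continuousOn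
      exact this ⟨hy0, hx0⟩
    have hwU := hUc.segment_subset hx hy hw
    have hd := dist_add_dist_of_mem_segment hw
    rw [dist_eq_norm, dist_eq_norm, dist_eq_norm] at hd
    have h1 := (hp x hx hx0).2 w hwU hw0.ge
    have h2 := (hm w hwU (by simp [hw0])).2 y hy (by simpa using hy0)
    have h3 : ‖x - w‖ ^ α ≤ ‖x - y‖ ^ α :=
      Real.rpow_le_rpow (norm_nonneg _) (by linarith [norm_nonneg (w - y)]) hα0.le
    have h4 : ‖w - y‖ ^ α ≤ ‖x - y‖ ^ α :=
      Real.rpow_le_rpow (norm_nonneg _) (by linarith [norm_nonneg (x - w)]) hα0.le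
    calc ‖f x - f y‖ ≤ ‖f x - f w‖ + ‖f w - f y‖ := norm_sub_le_norm_sub_add_norm_sub _ _ _
      _ ≤ M * ‖x - y‖ ^ α + M * ‖x - y‖ ^ α := by
        gcongr
        · exact h1.trans (by gcongr)
        · exact h2.trans (by gcongr)
      _ = _ := by ring
  refine ⟨by positivity, fun x hx => ?_, fun x hx y hy => ?_⟩
  · rcases le_total 0 (τ x) with h0 | h0
    · linarith [(hp x hx h0).1]
    · linarith [(hm x hx (by simpa using h0)).1]
  · rcases le_total 0 (τ x) with h0 | h0 <;> rcases le_total 0 (τ y) with h1 | h1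
    · refine ((hp x hx h0).2 y hy h1).trans ?_
      gcongr
      linarith
    · exact cross x hx y hy h0 h1
    · rw [norm_sub_rev, norm_sub_rev x]
      exact cross y hy x hx h1 h0
    · refine ((hm x hx (by simpa using h0)).2 y hy (by simpa using h1)).trans ?_
      gcongr
      linarith

/-- `differentiableOn_of_halfSpaces` applies to `f` and then to its derivative. Agreement is asked
only of the derivative limits, since agreement of the values is the continuity of `f`. -/
theorem HolderBd.glue_two {α M : ℝ} (hα0 : 0 < α) (he : τ e = 1) (hU : IsOpen U)
    (hUc : Convex ℝ U) {f : E → F} (hc : ContinuousOn f U)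
    (h : HolderBd α (U ∩ {z | 0 < τ z}) M 2 f) (h' : HolderBd α (U ∩ {z | 0 < (-τ) z}) M 2 f)
    (hjet : ∀ z ∈ U, τ z = 0 → ∃ f₀ f₁ f₂ g₀, JetTendsto (U ∩ {z | 0 < τ z}) z f f₀ f₁ f₂ ∧
      JetTendsto (U ∩ {z | 0 < (-τ) z}) z f g₀ f₁ f₂) :
    HolderBd α U (2 * M) 2 f := by
  have hM := h.nonneg
  obtain ⟨d1, c1⟩ := differentiableOn_of_halfSpaces he hU hc h.1 h'.1
    (h.2.2.continuousOn hα0) (h'.2.2.continuousOn hα0) fun z hz hτ => by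
      obtain ⟨_, f₁, _, _, h1, h2⟩ := hjet z hz hτ
      exact ⟨f₁, h1.3, h2.3⟩
  obtain ⟨d2, c2⟩ := differentiableOn_of_halfSpaces he hU c1 h.2.2.1 h'.2.2.1
    (h.2.2.2.2.continuousOn hα0) (h'.2.2.2.2.continuousOn hα0) fun z hz hτ => by
      obtain ⟨_, _, f₂, _, h1, h2⟩ := hjet z hz hτ
      exact ⟨f₂, h1.4, h2.4⟩
  have clos : ∀ {G : Type} [NormedAddCommGroup G] [NormedSpace ℝ G] (g : E → G), ContinuousOn g U →
      (∀ x ∈ U ∩ {z | 0 < τ z}, ‖g x‖ ≤ M) → (∀ x ∈ U ∩ {z | 0 < (-τ) z}, ‖g x‖ ≤ M) →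
      ∀ x ∈ U, ‖g x‖ ≤ 2 * M := by
    intro G _ _ g hg h1 h2 x hx
    rcases le_or_gt 0 (τ x) with h0 | h0
    · have : (𝓝[U ∩ {z | 0 < τ z}] x).NeBot :=
        mem_closure_iff_nhdsWithin_neBot.1 (mem_closure_inter_halfSpace he hU hx h0)
      have := le_of_tendsto ((hg.continuousAt (hU.mem_nhds hx)).tendsto.mono_left
        nhdsWithin_le_nhds).norm (Filter.eventually_of_mem self_mem_nhdsWithin h1)
      linarith
    · linarith [h2 x ⟨hx, by simpa using h0⟩]
  exact ⟨d1, clos _ hc h.bound h'.bound, d2, clos _ c1 h.2.2.bound h'.2.2.bound,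
    HolderBd.glue_zero hα0 he hU hUc c2 h.2.2.2.2 h'.2.2.2.2⟩

end HalfSpace

/-! ### The bent odd reflection in flat coordinates. -/

section Reflection

variable {E F : Type} [NormedAddCommGroup E] [NormedSpace ℝ E] [NormedAddCommGroup F]
  [NormedSpace ℝ F] {τ : E →L[ℝ] ℝ} {e : E} {U : Set E}

/-- A function vanishing on the hyperplane has no tangential first derivatives and no second
derivatives in two tangential directions. Splitting `x = (x - τ(x) e) + τ(x) e` leaves only normal
and mixed terms. -/
theorem JetTendsto.eq_of_vanishing (he : τ e = 1) (hU : IsOpen U) {v : E → ℝ}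
    (hv : ∀ z ∈ U, τ z = 0 → ∃ v₀ v₁ v₂, JetTendsto (U ∩ {z | 0 < τ z}) z v v₀ v₁ v₂)
    (hv0 : ∀ z ∈ U, τ z = 0 → Filter.Tendsto v (𝓝[U ∩ {z | 0 < τ z}] z) (𝓝 0))
    {z : E} (hz : z ∈ U) (hτ : τ z = 0) {v₀ v₁ v₂}
    (h : JetTendsto (U ∩ {z | 0 < τ z}) z v v₀ v₁ v₂) :
    (∀ x, v₁ x = τ x * v₁ e) ∧
      ∀ x y, v₂ x y = τ x * v₂ e y + τ y * v₂ e x - τ x * τ y * v₂ e e := by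
  have ho := hU.inter (isOpen_halfSpace τ)
  have h1 : ∀ z ∈ U, τ z = 0 → ∀ v₀ v₁ v₂, JetTendsto (U ∩ {z | 0 < τ z}) z v v₀ v₁ v₂ →
      ∀ x, τ x = 0 → v₁ x = 0 := fun z hz hτ v₀ v₁ v₂ h x hx =>
    fderiv_tangential_eq_zero he hU hz hτ (h.1.differentiableOn (by simp)) hv0 h.3 hx
  -- By `h1` the tangential derivative `w ↦ Dv(w) y` again tends to zero on the hyperplane, so the
  -- first-order argument applies to it.
  have h2 : ∀ x y, τ x = 0 → τ y = 0 → v₂ x y = 0 := by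
    intro x y hx hy
    have hd : ∀ w ∈ U ∩ {z | 0 < τ z}, HasFDerivAt (fun w => fderiv ℝ v w y)
        ((fderiv ℝ (fderiv ℝ v) w).flip y) w := fun w hw => by
      have := (h.1.differentiableAt_fderiv ho hw).2.hasFDerivAt.clm_apply
        (hasFDerivAt_const y w)
      simpa using this
    have := fderiv_tangential_eq_zero (f := fun w => fderiv ℝ v w y) (L := v₂.flip y) he hU hz hτ
      (fun w hw => (hd w hw).differentiableAt.differentiableWithinAt) (fun w hw hw0 => ?_) ?_ hx
    · simpa using this
    · obtain ⟨w₀, w₁, w₂, hw'⟩ := hv w hw hw0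
      have h3 := hw'.3.continuousLinearMap_apply (tendsto_const_nhds (x := y))
      rwa [h1 w hw hw0 _ _ _ hw' y hy] at h3
    · refine Filter.Tendsto.congr' (Filter.eventuallyEq_of_mem self_mem_nhdsWithin
        fun w hw => (hd w hw).fderiv.symm) ?_
      have hc : Continuous fun A : E →L[ℝ] E →L[ℝ] ℝ => A.flip y :=
        (ContinuousLinearMap.flipₗᵢ ℝ E E ℝ).continuous.clm_apply continuous_const
      exact (hc.tendsto v₂).comp h.4
  have hsymm := h.symm ho (mem_closure_inter_halfSpace he hU hz hτ.ge)
  have hdec : ∀ x, τ (x - τ x • e) = 0 := fun x => by simp [he]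
  refine ⟨fun x => ?_, fun x y => ?_⟩
  · have := h1 z hz hτ _ _ _ h _ (hdec x)
    simp only [map_sub, map_smul, smul_eq_mul] at this
    linarith
  · have := h2 _ _ (hdec x) (hdec y)
    simp only [map_sub, map_smul, smul_eq_mul, sub_apply, smul_apply] at this
    rw [hsymm x e] at this
    linarith

/-- At `z` the derivative of `S` is `x ↦ x + τ(x) q₀`, and its second derivative is `τ(x) q₁ y +
τ(y) q₁ x + 2 τ(x) τ(y) p₀`. Reflection and the outer minus sign cancel on the first derivative and
on the mixed second ones. The coefficient of `τ(x) τ(y)` matches if `-(v₂ e e + 2 v₂ e q₀ + 2 v₁ p₀)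
= v₂ e e`, which is `hcond`. -/
theorem JetTendsto.reflection_eq {z : E} (he : τ e = 1) (hτz : τ z = 0) {B B' B₁ : Set E}
    (hB : IsOpen B) (hB' : IsOpen B') (hB₁ : IsOpen B₁) (hBB : B' ⊆ B)
    (hzB : (𝓝[B] z).NeBot) {q p : E → E}
    (hτq : ∀ z ∈ B, τ (q z) = 0)
    {S ρ : E → E} (hSdef : ∀ z, S z = z + τ z • q z + τ z • τ z • p z)
    (hρ : ∀ z, ρ z = z - (2 * τ z) • e)
    (hS : Set.MapsTo S B' B) (hρm : Set.MapsTo ρ B₁ B')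
    {q₀ q₁ q₂ p₀ p₁ p₂} (hq : JetTendsto B z q q₀ q₁ q₂) (hp : JetTendsto B z p p₀ p₁ p₂)
    {v : E → ℝ} {v₀ v₁ v₂} (hv : JetTendsto B z v v₀ v₁ v₂)
    (hv1 : ∀ x, v₁ x = τ x * v₁ e)
    (hv2 : ∀ x y, v₂ x y = τ x * v₂ e y + τ y * v₂ e x - τ x * τ y * v₂ e e)
    (hcond : v₂ e e + v₂ e q₀ + v₁ p₀ = 0) :
    JetTendsto B₁ z (fun x => -v (S (ρ x))) (-v₀) v₁ v₂ := by
  have hτq0 : τ q₀ = 0 := by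
    refine tendsto_nhds_unique ((τ.continuous.tendsto q₀).comp hq.2)
      (tendsto_const_nhds.congr' ?_)
    filter_upwards [self_mem_nhdsWithin] with w hw
    exact (hτq w hw).symm
  -- Since `q` is tangential on all of `B`, so are its derivatives; hence `v₁` kills the terms with
  -- `q₁`.
  have hτq1 : ∀ x, τ (q₁ x) = 0 := by
    intro x
    refine tendsto_nhds_unique ((τ.continuous.tendsto _).comp
      (hq.3.continuousLinearMap_apply tendsto_const_nhds)) (tendsto_const_nhds.congr' ?_)
    filter_upwards [self_mem_nhdsWithin] with w hw
    have h1 := (τ.hasFDerivAt.comp w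
      (hq.1.differentiableAt_fderiv hB hw).1.hasFDerivAt).fderiv
    have h2 : (τ ∘ q) =ᶠ[𝓝 w] fun _ => 0 :=
      Filter.eventually_of_mem (hB.mem_nhds hw) hτq
    rw [h2.fderiv_eq] at h1
    have := congrArg (fun A : E →L[ℝ] ℝ => A x) h1
    simpa using this
  have hSj := (((ContinuousLinearMap.id ℝ E).jetTendsto (S := B) z).add hB
    (hq.smul_clm hB τ hτz)).add hB ((hp.smul_clm hB τ hτz).smul_clm hB τ hτz)
  have hSj' := (hSj.congr hB (g := S) fun w _ => (hSdef w).symm).mono hBB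
  simp only [add_zero, ContinuousLinearMap.id_apply, map_zero] at hSj'
  obtain ⟨f₂, hf2, hvS⟩ := hv.comp hB' hB hSj' hS
  let R : E →L[ℝ] E := ContinuousLinearMap.id ℝ E - (2 : ℝ) • τ.smulRight e
  have hR : ∀ x, R x = x - (2 * τ x) • e := fun x => by simp [R, smul_smul]
  have hRz : R z = z := by simp [hR, hτz]
  have hRj := (R.jetTendsto (S := B₁) z).congr (g := ρ) hB₁ fun w _ => by rw [hR, hρ]
  rw [hRz] at hRj
  obtain ⟨g₂, hg2, hvR⟩ := hvS.comp hB₁ hB' hRj hρm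
  have hτR : ∀ x, τ (R x) = -τ x := fun x => by
    simp only [hR, map_sub, map_smul, smul_eq_mul, he]; ring
  convert hvR.neg using 1
  · ext x
    rw [hv1]
    simp [hv1 q₀, hv1 (R x), hτR, hτq0]
  · ext x y
    have hp1 : v₁ p₀ = -(v₂ e e + v₂ e q₀) := by linarith
    simp only [neg_apply, hg2, hf2]
    simp [hv2 x, hv2 q₀, hv1 (q₁ _), he, hτq0, hτq1, hp1, hR]
    ring

/-- The radius, the map `S` and the constant are fixed before `v`; this uniformity makes the later
extension linear and bounded. -/
theorem HolderBd.exists_reflection [FiniteDimensional ℝ E] {α : ℝ} (hα0 : 0 < α) (hα : α ≤ 1)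
    (he : τ e = 1) (hrefl : ∀ z, ‖z - (2 * τ z) • e‖ = ‖z‖) {z₀ : E} (hz₀ : τ z₀ = 0) {r : ℝ}
    (hr0 : 0 < r) (hr : r ≤ 1 / 2) {q : E → E} {κ : E → ℝ} {K K' : ℝ}
    (hq : HolderBd α (Metric.ball z₀ r ∩ {z | 0 < τ z}) K 2 q)
    (hκ : HolderBd α (Metric.ball z₀ r ∩ {z | 0 < τ z}) K' 2 κ)
    (hτq : ∀ z ∈ Metric.ball z₀ r ∩ {z | 0 < τ z}, τ (q z) = 0) :
    ∃ (δ : ℝ) (S : E → E), 0 < δ ∧ δ ≤ r ∧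
      Set.MapsTo S (Metric.ball z₀ δ ∩ {z | 0 < τ z}) (Metric.ball z₀ r ∩ {z | 0 < τ z}) ∧
      ∃ C : ℝ, 0 ≤ C ∧ ∀ (v : E → ℝ) (M : ℝ),
        HolderBd α (Metric.ball z₀ r ∩ {z | 0 < τ z}) M 2 v →
        (∀ z ∈ Metric.ball z₀ r, τ z = 0 → v z = 0 ∧
          Filter.Tendsto v (𝓝[Metric.ball z₀ r ∩ {z | 0 < τ z}] z) (𝓝 0)) →
        (∀ z ∈ Metric.ball z₀ r, τ z = 0 → ∀ v₀ v₁ v₂ q₀ κ₀,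
          JetTendsto (Metric.ball z₀ r ∩ {z | 0 < τ z}) z v v₀ v₁ v₂ →
          Filter.Tendsto q (𝓝[Metric.ball z₀ r ∩ {z | 0 < τ z}] z) (𝓝 q₀) →
          Filter.Tendsto κ (𝓝[Metric.ball z₀ r ∩ {z | 0 < τ z}] z) (𝓝 κ₀) →
          v₂ e e + v₂ e q₀ + κ₀ * v₁ e = 0) →
        HolderBd α (Metric.ball z₀ δ) (C * M) 2
          (fun z => if 0 ≤ τ z then v z else -v (S (z - (2 * τ z) • e))) := by
  classical
  have hBs := (smallConvex_ball (z := z₀) hr).inter_halfSpace τ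
  set B := Metric.ball z₀ r ∩ {z | 0 < τ z} with hBdef
  let p : E → E := fun z => κ z • e
  have hp : HolderBd α B _ 2 p := hκ.clm hα hBs ((ContinuousLinearMap.id ℝ ℝ).smulRight e)
  set P := 2 ^ (2 + 1) * ‖(ContinuousLinearMap.id ℝ ℝ).smulRight e‖ * K'
  let S : E → E := fun z => z + τ z • q z + τ z • τ z • p z
  obtain ⟨Kid, hid⟩ := ContDiff.exists_holderBd (k := 2) hα (contDiff_id (E := E) (𝕜 := ℝ)) hBs
  obtain ⟨Kτ, hτ⟩ := ContDiff.exists_holderBd (k := 2) hα τ.contDiff hBs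
  have hSH := (hid.add hBs.isOpen (hτ.smul hα hBs hq)).add hBs.isOpen
    (hτ.smul hα hBs (hτ.smul hα hBs hp))
  set KS := Kid + 2 ^ (2 + 1) * Kτ * K + 2 ^ (2 + 1) * Kτ * (2 ^ (2 + 1) * Kτ * P)
  have hK := hq.nonneg
  have hK' := hκ.nonneg
  have hP := hp.nonneg
  -- The first three terms bound the expansion of `S` about `z₀`, so radius `r / A` keeps the image
  -- in the ball of radius `r`. The last gives `|τ κ| < r ≤ 1 / 2`, so `τ (S z) = τ z * (1 + τ z * κ
  -- z)` stays positive.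
  let A : ℝ := 1 + ‖τ‖ * K + ‖τ‖ * ‖τ‖ * P + ‖τ‖ * K'
  have hA : 1 ≤ A := by
    have : 0 ≤ ‖τ‖ * K + ‖τ‖ * ‖τ‖ * P + ‖τ‖ * K' := by positivity
    simp only [A]
    linarith
  have hA0 : 0 < A := by linarith
  let δ : ℝ := r / A
  have hδ0 : 0 < δ := by positivity
  have hδr : δ ≤ r := div_le_self hr0.le hA
  have hδA : δ * A = r := div_mul_cancel₀ _ hA0.ne'
  have hsub : Metric.ball z₀ δ ⊆ Metric.ball z₀ r := Metric.ball_subset_ball hδr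
  have hτz : ∀ z ∈ Metric.ball z₀ δ, |τ z| ≤ ‖τ‖ * ‖z - z₀‖ := fun z _ => by
    have := τ.le_opNorm (z - z₀)
    rwa [map_sub, hz₀, sub_zero] at this
  have hmaps : Set.MapsTo S (Metric.ball z₀ δ ∩ {z | 0 < τ z}) B := by
    rintro z ⟨hz, hz0 : 0 < τ z⟩
    have hzB : z ∈ B := ⟨hsub hz, hz0⟩
    have h1 := hτz z hz
    rw [abs_of_pos hz0] at h1
    rw [mem_ball_iff_norm] at hz
    have hz1 : ‖z - z₀‖ ≤ 1 := by linarith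
    have hκb := hκ.bound z hzB
    rw [Real.norm_eq_abs] at hκb
    have hτs : τ z ≤ ‖τ‖ := h1.trans (mul_le_of_le_one_right (norm_nonneg _) hz1)
    refine ⟨?_, ?_⟩
    · rw [mem_ball_iff_norm]
      have e1 : S z - z₀ = (z - z₀) + τ z • q z + τ z • τ z • p z := by simp only [S]; abel
      have n1 : ‖τ z • q z‖ ≤ ‖τ‖ * ‖z - z₀‖ * K := by
        rw [norm_smul, Real.norm_of_nonneg hz0.le]
        gcongr
        exact hq.bound z hzB
      have n2 : ‖τ z • τ z • p z‖ ≤ ‖τ‖ * ‖z - z₀‖ * (‖τ‖ * P) := by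
        rw [norm_smul, norm_smul, Real.norm_of_nonneg hz0.le]
        gcongr
        exact hp.bound z hzB
      have n3 : 0 ≤ ‖z - z₀‖ * (‖τ‖ * K') := by positivity
      calc ‖S z - z₀‖ ≤ ‖z - z₀‖ + ‖τ z • q z‖ + ‖τ z • τ z • p z‖ := by
            rw [e1]; exact norm_add₃_le
        _ ≤ ‖z - z₀‖ * A := by simp only [A]; linarith
        _ < δ * A := by gcongr
        _ = r := hδA
    · change 0 < τ (S z)
      have e2 : τ (S z) = τ z * (1 + τ z * κ z) := by
        simp only [S, p, map_add, map_smul, hτq z hzB, he, smul_eq_mul]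
        ring
      rw [e2]
      have h3 : |τ z * κ z| ≤ ‖τ‖ * ‖z - z₀‖ * K' := by
        rw [abs_mul, abs_of_pos hz0]
        gcongr
      have h4 : ‖τ‖ * ‖z - z₀‖ * K' ≤ ‖z - z₀‖ * A := by
        have : 0 ≤ ‖z - z₀‖ * (1 + ‖τ‖ * K + ‖τ‖ * ‖τ‖ * P) := by positivity
        simp only [A]
        linarith
      have h5 : ‖z - z₀‖ * A < r := by
        rw [← hδA]
        gcongr
      have h6 := (abs_le.1 h3).1
      have h7 : 0 < 1 + τ z * κ z := by linarith
      positivity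
  have hB's := (smallConvex_ball (z := z₀) (hδr.trans hr)).inter_halfSpace τ
  have hB1s := (smallConvex_ball (z := z₀) (hδr.trans hr)).inter_halfSpace (-τ)
  set B' := Metric.ball z₀ δ ∩ {z | 0 < τ z} with hB'def
  set B₁ := Metric.ball z₀ δ ∩ {z | 0 < (-τ) z} with hB₁def
  have hB'B : B' ⊆ B := Set.inter_subset_inter_left _ hsub
  let ρ : E → E := fun z => z - (2 * τ z) • e
  have hτρ : ∀ z, τ (ρ z) = -τ z := fun z => by
    simp only [ρ, map_sub, map_smul, smul_eq_mul, he]; ring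
  have hρball : ∀ z ∈ Metric.ball z₀ δ, ρ z ∈ Metric.ball z₀ δ := fun z hz => by
    rw [mem_ball_iff_norm] at hz ⊢
    have : ρ z - z₀ = (z - z₀) - (2 * τ (z - z₀)) • e := by
      simp only [ρ, map_sub, hz₀, sub_zero]; abel
    rwa [this, hrefl]
  have hρm : Set.MapsTo ρ B₁ B' := fun z hz => ⟨hρball z hz.1, by
    have : 0 < (-τ) z := hz.2
    simpa [hτρ] using this⟩
  have hρc : ContDiff ℝ (⊤ : ℕ∞) ρ :=
    contDiff_id.sub ((contDiff_const.mul τ.contDiff).smul contDiff_const)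
  obtain ⟨Kρ, hρH⟩ := ContDiff.exists_holderBd (k := 2) hα hρc hB1s
  obtain ⟨C₁, hC₁, hcomp₁⟩ := HolderBd.exists_comp hα0 hα hB's hBs.isOpen
    (hSH.mono_set hB'B) (fun x hx y hy => hSH.lipschitz hBs x (hB'B hx) y (hB'B hy)) hmaps
  obtain ⟨C₂, hC₂, hcomp₂⟩ := HolderBd.exists_comp hα0 hα hB1s hB's.isOpen hρH
    (hρH.lipschitz hB1s) hρm
  -- The maximum covers the unchanged side and the reflected side; the two comes from gluing.
  refine ⟨δ, S, hδ0, hδr, hmaps, 2 * max 1 (C₂ * C₁), by positivity, fun v M hv hv0 hcond => ?_⟩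
  have hM := hv.nonneg
  let w : E → ℝ := fun z => if 0 ≤ τ z then v z else -v (S (ρ z))
  have hw1 : Set.EqOn v w B' := fun z hz => (if_pos (le_of_lt hz.2)).symm
  have hw2 : Set.EqOn (fun z => -v (S (ρ z))) w B₁ := fun z hz =>
    (if_neg (by have : 0 < (-τ) z := hz.2; simpa using this)).symm
  have hwp : HolderBd α B' (max 1 (C₂ * C₁) * M) 2 w :=
    ((hv.mono_set hB'B).congr hB's.isOpen hw1).mono_const
      (le_mul_of_one_le_left hM (le_max_left _ _))
  have hwm : HolderBd α B₁ (max 1 (C₂ * C₁) * M) 2 w := by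
    refine (((hcomp₂ _ _ (hcomp₁ _ _ hv)).neg hB1s.isOpen).congr hB1s.isOpen hw2).mono_const ?_
    rw [← mul_assoc]
    gcongr
    exact le_max_right _ _
  have hclos : ∀ z ∈ Metric.ball z₀ r, τ z = 0 → z ∈ closure B := fun z hz h0 =>
    mem_closure_inter_halfSpace he Metric.isOpen_ball hz h0.ge
  have hjets : ∀ z ∈ Metric.ball z₀ r, τ z = 0 → ∃ v₁ v₂, JetTendsto B z v 0 v₁ v₂ := by
    intro z hz h0
    obtain ⟨v₀, v₁, v₂, h⟩ := hv.exists_jetTendsto hα0 hα hBs (hclos z hz h0)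
    have : (𝓝[B] z).NeBot := mem_closure_iff_nhdsWithin_neBot.1 (hclos z hz h0)
    obtain rfl := tendsto_nhds_unique h.2 (hv0 z hz h0).2
    exact ⟨v₁, v₂, h⟩
  have hboth : ∀ z ∈ Metric.ball z₀ δ, τ z = 0 → ∃ v₁ v₂, JetTendsto B' z w 0 v₁ v₂ ∧
      JetTendsto B₁ z w 0 v₁ v₂ := by
    intro z hz h0
    have hzB := hclos z (hsub hz) h0
    have hne : (𝓝[B] z).NeBot := mem_closure_iff_nhdsWithin_neBot.1 hzB
    obtain ⟨v₁, v₂, h⟩ := hjets z (hsub hz) h0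
    obtain ⟨q₀, q₁, q₂, hqj⟩ := hq.exists_jetTendsto hα0 hα hBs hzB
    obtain ⟨p₀, p₁, p₂, hpj⟩ := hp.exists_jetTendsto hα0 hα hBs hzB
    obtain ⟨κ₀, hκt⟩ := hκ.exists_tendsto hα0 hα hBs hzB
    obtain rfl : p₀ = κ₀ • e := tendsto_nhds_unique hpj.2 (hκt.smul_const e)
    obtain ⟨t1, t2⟩ := h.eq_of_vanishing he Metric.isOpen_ball
      (fun z hz h0 => by
        obtain ⟨v₁, v₂, h⟩ := hjets z hz h0
        exact ⟨_, _, _, h⟩) (fun z hz h0 => (hv0 z hz h0).2) (hsub hz) h0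
    have hc := hcond z (hsub hz) h0 _ _ _ _ _ h hqj.2 hκt
    have := JetTendsto.reflection_eq he h0 hBs.isOpen hB's.isOpen hB1s.isOpen hB'B hne
      hτq (fun _ => rfl) (fun _ => rfl) hmaps hρm hqj hpj h t1 t2
      (by simpa using hc)
    refine ⟨v₁, v₂, (h.mono hB'B).congr hB's.isOpen hw1, ?_⟩
    simpa using this.congr hB1s.isOpen hw2
  have hwc : ContinuousOn w (Metric.ball z₀ δ) := by
    intro z hz
    refine ContinuousAt.continuousWithinAt ?_
    rcases lt_trichotomy (τ z) 0 with h | h | h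
    · have : z ∈ B₁ := ⟨hz, by simpa using h⟩
      exact (hwm.continuousOn hα0).continuousAt (hB1s.isOpen.mem_nhds this)
    · obtain ⟨v₁, v₂, h1, h2⟩ := hboth z hz h
      have hw0 : ∀ y ∈ Metric.ball z₀ δ, τ y = 0 → w y = 0 := fun y hy hy0 => by
        simp only [w, hy0, le_refl, if_true]
        exact (hv0 y (hsub hy) hy0).1
      rw [ContinuousAt, hw0 z hz h, (nhds_basis_opens (0 : ℝ)).tendsto_right_iff]
      rintro V ⟨hV0, hV⟩
      have h1' := h1.2.eventually (hV.mem_nhds hV0)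
      have h2' := h2.2.eventually (hV.mem_nhds hV0)
      rw [eventually_nhdsWithin_iff] at h1' h2'
      filter_upwards [h1', h2', Metric.isOpen_ball.mem_nhds hz] with y hy1 hy2 hy
      rcases lt_trichotomy (τ y) 0 with h3 | h3 | h3
      · exact hy2 ⟨hy, by simpa using h3⟩
      · rw [hw0 y hy h3]; exact hV0
      · exact hy1 ⟨hy, h3⟩
    · have : z ∈ B' := ⟨hz, h⟩
      exact (hwp.continuousOn hα0).continuousAt (hB's.isOpen.mem_nhds this)
  have := HolderBd.glue_two hα0 he Metric.isOpen_ball (convex_ball _ _) hwc hwp hwm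
    fun z hz h0 => by
      obtain ⟨v₁, v₂, h1, h2⟩ := hboth z hz h0
      exact ⟨_, _, _, _, h1, h2⟩
  rwa [← mul_assoc] at this

end Reflection

/-! ### Hölder bounds on the domain and its charts, and the boundary form of the operator. -/

section Domain

theorem zeroExt_apply {n : ℕ} {Ω : TopologicalSpace.Opens (Rn n)} (u : Clo Ω → ℝ) (x : Clo Ω) :
    zeroExt Ω u x.val = u x :=
  Subtype.val_injective.extend_apply u 0 x

theorem continuousOn_zeroExt {n : ℕ} {Ω : TopologicalSpace.Opens (Rn n)} {u : Clo Ω → ℝ}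
    (hu : Continuous u) : ContinuousOn (zeroExt Ω u) (closure (Ω : Set (Rn n))) := by
  rw [continuousOn_iff_continuous_domRestrict]
  convert hu using 1
  funext x
  exact zeroExt_apply u x

theorem holderOnWith_iff_norm {E F : Type} [NormedAddCommGroup E] [NormedAddCommGroup F]
    {f : E → F} {S : Set E} {K α : ℝ≥0} :
    HolderOnWith K α f S ↔ ∀ x ∈ S, ∀ y ∈ S, ‖f x - f y‖ ≤ K * ‖x - y‖ ^ (α : ℝ) := by
  refine forall₂_congr fun x _ => forall₂_congr fun y _ => ?_
  rw [edist_nndist, edist_nndist, ← ENNReal.coe_rpow_of_nonneg _ α.coe_nonneg, ← ENNReal.coe_mul,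
    ENNReal.coe_le_coe, ← NNReal.coe_le_coe]
  simp [dist_eq_norm]

/-- Derivatives extend continuously to the closure of the bounded set `Ω`, which is compact, so they
are bounded. -/
theorem IsHolderUpToBoundary.exists_holderBd {n k : ℕ} {α : ℝ≥0} (hα : 0 < α)
    {Ω : TopologicalSpace.Opens (Rn n)} (hbdd : Bornology.IsBounded (Ω : Set (Rn n)))
    {u : Clo Ω → ℝ} (hu : IsHolderUpToBoundary k α Ω u) :
    ∃ M, HolderBd (α : ℝ) (Ω : Set (Rn n)) M k (zeroExt Ω u) := by
  have hb : ∀ j, ∃ C : ℝ, 0 ≤ C ∧ (j ≤ k → ∀ x ∈ Ω, ‖iteratedFDeriv ℝ j (zeroExt Ω u) x‖ ≤ C) := by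
    intro j
    by_cases hj : j ≤ k
    · obtain ⟨g, hg, hg'⟩ := hu.extends_cont j hj
      have : CompactSpace (Clo Ω) := isCompact_iff_compactSpace.1 hbdd.isCompact_closure
      obtain ⟨C, hC⟩ := isCompact_univ.exists_bound_of_continuousOn hg.continuousOn
      refine ⟨max C 0, le_max_right _ _, fun _ x hx => ?_⟩
      rw [show iteratedFDeriv ℝ j (zeroExt Ω u) x = g ⟨x, subset_closure hx⟩ from
        (hg' ⟨x, subset_closure hx⟩ hx).symm]
      exact (hC _ trivial).trans (le_max_left _ _)
    · exact ⟨0, le_rfl, fun h => absurd h hj⟩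
  choose C hC0 hC using hb
  obtain ⟨K, hK⟩ := hu.holder
  rw [holderOnWith_iff_norm] at hK
  have hsum : 0 ≤ ∑ j ∈ Finset.range (k + 1), C j := Finset.sum_nonneg fun j _ => hC0 j
  refine ⟨∑ j ∈ Finset.range (k + 1), C j + K, (holderBd_iff_iteratedFDeriv (by exact_mod_cast hα)
    Ω.isOpen (by positivity)).2 ⟨hu.contDiffOn, fun j hj x hx => ?_, fun x hx y hy => ?_⟩⟩
  · refine (hC j hj x hx).trans ((Finset.single_le_sum (fun j _ => hC0 j)
      (Finset.mem_range.2 (Nat.lt_succ_of_le hj))).trans ?_)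
    simp
  · refine (hK x hx y hy).trans ?_
    gcongr
    simpa using hsum

/-- Near `x` each derivative exceeds its norm at `x` by less than one, by continuity. Radius at most
`1 / 2` makes the ball a `SmallConvex` set. -/
theorem IsHolderMapOn.exists_holderBd {n k : ℕ} {α : ℝ≥0} (hα : 0 < α) {f : Rn n → Rn n}
    {U : Set (Rn n)} (hU : IsOpen U) (hf : IsHolderMapOn k α f U) {x : Rn n} (hx : x ∈ U) :
    ∃ r M, 0 < r ∧ r ≤ 1 / 2 ∧ Metric.ball x r ⊆ U ∧ HolderBd (α : ℝ) (Metric.ball x r) M k f := by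
  obtain ⟨W, hW, K, hK⟩ := hf.2 x hx
  rw [holderOnWith_iff_norm] at hK
  have hcd := hf.1.contDiffAt (hU.mem_nhds hx)
  have hc : ∀ j ∈ Finset.range (k + 1), ∀ᶠ y in 𝓝 x,
      ‖iteratedFDeriv ℝ j f y‖ < ‖iteratedFDeriv ℝ j f x‖ + 1 := fun j hj => by
    have hjk : (j : WithTop ℕ∞) ≤ k := by
      exact_mod_cast Nat.le_of_lt_succ (Finset.mem_range.1 hj)
    have h1 : ContDiffAt ℝ 0 (iteratedFDeriv ℝ j f) x :=
      hcd.iteratedFDeriv_right (by simpa using hjk)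
    exact h1.continuousAt.norm.eventually_lt continuousAt_const (by simp)
  have hall := (Filter.eventually_all_finset _).2 hc
  obtain ⟨ε, hε, hsub⟩ := Metric.mem_nhds_iff.1
    (Filter.inter_mem (Filter.inter_mem hW (hU.mem_nhds hx)) hall)
  have hsub' : Metric.ball x (min ε (1 / 2)) ⊆ _ :=
    (Metric.ball_subset_ball (min_le_left _ _)).trans hsub
  have h0 : ∀ j ∈ Finset.range (k + 1), 0 ≤ ‖iteratedFDeriv ℝ j f x‖ + 1 := fun j _ => by positivity
  have hsum := Finset.sum_nonneg h0
  refine ⟨min ε (1 / 2), ∑ j ∈ Finset.range (k + 1), (‖iteratedFDeriv ℝ j f x‖ + 1) + K,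
    by positivity, min_le_right _ _, fun y hy => (hsub' hy).1.2,
    (holderBd_iff_iteratedFDeriv (by exact_mod_cast hα) Metric.isOpen_ball (by positivity)).2
      ⟨hf.1.mono fun y hy => (hsub' hy).1.2, fun j hj y hy => ?_, fun y hy y' hy' => ?_⟩⟩
  · have hj' := Finset.mem_range.2 (Nat.lt_succ_of_le hj)
    refine ((hsub' hy).2 j hj').le.trans ((Finset.single_le_sum h0 hj').trans ?_)
    simp
  · refine (hK y (hsub' hy).1.1 y' (hsub' hy').1.1).trans ?_
    gcongr
    simpa using hsum

/-- The last coordinate. -/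
noncomputable def lastCoord (d : ℕ) : Rn (d + 1) →L[ℝ] ℝ := EuclideanSpace.proj (Fin.last d)

@[simp] theorem lastCoord_apply {d : ℕ} (z : Rn (d + 1)) : lastCoord d z = z (Fin.last d) := rfl

theorem lastCoord_unitVec (d : ℕ) : lastCoord d (unitVec (Fin.last d)) = 1 := by
  simp [unitVec]

theorem norm_sub_two_lastCoord {d : ℕ} (z : Rn (d + 1)) :
    ‖z - (2 * lastCoord d z) • unitVec (Fin.last d)‖ = ‖z‖ := by
  rw [EuclideanSpace.norm_eq, EuclideanSpace.norm_eq]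
  congr 1
  refine Finset.sum_congr rfl fun i _ => ?_
  by_cases hi : i = Fin.last d
  · subst hi
    simp [unitVec]
    ring
  · simp [unitVec, hi]

/-- The algebraic identity behind the choice of the reflection: the boundary values of
`∑ aᵢⱼ ∂ᵢ∂ⱼ + ∑ bᵢ ∂ᵢ` in coordinates in which the function vanishes on a hyperplane. -/
theorem boundary_operator_eq {E ι : Type} [Fintype ι] [NormedAddCommGroup E] [NormedSpace ℝ E]
    {τ : E →L[ℝ] ℝ} {e : E} {v₁ : E →L[ℝ] ℝ} {v₂ : E →L[ℝ] E →L[ℝ] ℝ}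
    (hv1 : ∀ x, v₁ x = τ x * v₁ e)
    (hv2 : ∀ x y, v₂ x y = τ x * v₂ e y + τ y * v₂ e x - τ x * τ y * v₂ e e)
    {a : Matrix ι ι ℝ} (ha : a.IsSymm) (b : ι → ℝ) (p : ι → E) (Q : ι → ι → E) :
    (∑ i, ∑ j, a i j * (v₂ (p i) (p j) + v₁ (Q i j))) + ∑ i, b i * v₁ (p i) =
      2 * v₂ e (∑ i, ∑ j, (a i j * τ (p i)) • p j) -
        τ (∑ i, ∑ j, (a i j * τ (p i)) • p j) * v₂ e e +
        τ ((∑ i, ∑ j, a i j • Q i j) + ∑ i, b i • p i) * v₁ e := by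
  have h1 : ∑ i, ∑ j, a i j * (τ (p j) * v₂ e (p i)) = ∑ i, ∑ j, a i j * (τ (p i) * v₂ e (p j)) := by
    rw [Finset.sum_comm]
    exact Finset.sum_congr rfl fun i _ => Finset.sum_congr rfl fun j _ => by rw [ha.apply]
  have h2 : ∀ i j, a i j * (v₂ (p i) (p j) + v₁ (Q i j)) = a i j * (τ (p i) * v₂ e (p j)) +
      a i j * (τ (p j) * v₂ e (p i)) - a i j * τ (p i) * τ (p j) * v₂ e e +
      a i j * τ (Q i j) * v₁ e := fun i j => by
    rw [hv2 (p i), hv1 (Q i j)]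
    ring
  have h3 : ∀ i, b i * v₁ (p i) = b i * τ (p i) * v₁ e := fun i => by
    rw [hv1 (p i)]
    ring
  simp only [h2, h3, Finset.sum_add_distrib, Finset.sum_sub_distrib, h1, map_sum, map_smul, map_add,
    smul_eq_mul, ← Finset.sum_mul, add_mul]
  simp only [mul_assoc]
  ring

end Domain

/-! ### The condition `Lu = 0` in flat coordinates, and ellipticity. -/

section Local

/-- Limits at the boundary of `D(L)`-functions in flat coordinates satisfy the relation required by
the reflection. -/
theorem jet_condition_of_mem_opDomain {d : ℕ} {α : ℝ≥0} {Ω : TopologicalSpace.Opens (Rn (d + 1))}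
    {a : Clo Ω → Matrix (Fin (d + 1)) (Fin (d + 1)) ℝ}
    {b : Clo Ω → Fin (d + 1) → ℝ} {c : Clo Ω → ℝ} (hsymm : ∀ x, (a x).IsSymm)
    (ha : ∀ i j, Continuous fun x => a x i j) (hb : ∀ i, Continuous fun x => b x i)
    {u : Clo Ω → ℝ} (hu : u ∈ opDomain α Ω a b c)
    {φ ψ : Rn (d + 1) → Rn (d + 1)} {B V : Set (Rn (d + 1))} {z : Rn (d + 1)} {τ : Rn (d + 1) →L[ℝ] ℝ}
    {e : Rn (d + 1)} (hB : IsOpen B) (hV : IsOpen V) (hzB : z ∈ closure B) (hψz : ψ z ∈ V)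
    (hψc : ContinuousAt ψ z) (hψB : Set.MapsTo ψ B (Ω ∩ V)) (hφψ : ∀ w ∈ B, φ (ψ w) = w)
    (hψφ : ∀ x ∈ V, ψ (φ x) = x)
    (hφz : φ (ψ z) = z) (hφ : ContDiffOn ℝ 2 φ V) (hfr : ψ z ∈ frontier (Ω : Set (Rn (d + 1))))
    {v₀ v₁ v₂} (hv : JetTendsto B z (fun w => zeroExt Ω u (ψ w)) v₀ v₁ v₂)
    (hv1 : ∀ x, v₁ x = τ x * v₁ e)
    (hv2 : ∀ x y, v₂ x y = τ x * v₂ e y + τ y * v₂ e x - τ x * τ y * v₂ e e)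
    {X Y q : Rn (d + 1) → Rn (d + 1)} {κ : Rn (d + 1) → ℝ}
    (hX : ∀ w ∈ B, X w = ∑ i, ∑ j, (zeroExt Ω (fun x => a x i j) (ψ w) *
      τ (fderiv ℝ φ (ψ w) (unitVec i))) • fderiv ℝ φ (ψ w) (unitVec j))
    (hY : ∀ w ∈ B, Y w = (∑ i, ∑ j, zeroExt Ω (fun x => a x i j) (ψ w) •
      fderiv ℝ (fderiv ℝ φ) (ψ w) (unitVec i) (unitVec j)) +
      ∑ i, zeroExt Ω (fun x => b x i) (ψ w) • fderiv ℝ φ (ψ w) (unitVec i))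
    {δ : ℝ} (hδ : 0 < δ) (hs : ∀ w ∈ B, δ ≤ τ (X w))
    (hq : ∀ w ∈ B, q w = (2 * (τ (X w))⁻¹) • X w - (2 : ℝ) • e)
    (hκ : ∀ w ∈ B, κ w = (τ (X w))⁻¹ * τ (Y w))
    {q₀ κ₀} (hq0 : Filter.Tendsto q (𝓝[B] z) (𝓝 q₀)) (hκ0 : Filter.Tendsto κ (𝓝[B] z) (𝓝 κ₀)) :
    v₂ e e + v₂ e q₀ + κ₀ * v₁ e = 0 := by
  have hne : (𝓝[B] z).NeBot := mem_closure_iff_nhdsWithin_neBot.1 hzB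
  let x₁ : Clo Ω := ⟨ψ z, frontier_subset_closure hfr⟩
  -- jets of `u` at the boundary point
  let O : Set (Rn (d + 1)) := (V ∩ φ ⁻¹' B) ∩ Ω
  have hO : IsOpen O := (hφ.continuousOn.isOpen_inter_preimage hV hB).inter Ω.isOpen
  have hψO : Set.MapsTo ψ B O := fun w hw =>
    ⟨⟨(hψB hw).2, by rw [Set.mem_preimage, hφψ w hw]; exact hw⟩, (hψB hw).1⟩
  have hφO : Set.MapsTo φ O B := fun x hx => hx.1.2
  have hψt : Filter.Tendsto ψ (𝓝[B] z) (𝓝[O] (ψ z)) :=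
    tendsto_nhdsWithin_iff.2 ⟨hψc.tendsto.mono_left nhdsWithin_le_nhds,
      Filter.eventually_of_mem self_mem_nhdsWithin hψO⟩
  have hneO : (𝓝[O] (ψ z)).NeBot := hψt.neBot
  have hφd := hφ.contDiffAt (hV.mem_nhds hψz)
  have hφd1 : ContDiffAt ℝ 1 (fderiv ℝ φ) (ψ z) := hφd.fderiv_right (by norm_num)
  have hφd2 : ContDiffAt ℝ 0 (fderiv ℝ (fderiv ℝ φ)) (ψ z) := hφd1.fderiv_right (by norm_num)
  have hφj : JetTendsto O (ψ z) φ z (fderiv ℝ φ (ψ z)) (fderiv ℝ (fderiv ℝ φ) (ψ z)) :=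
    ⟨hφ.mono fun x hx => hx.1.1, by
      have := hφd.continuousAt.tendsto
      rw [hφz] at this
      exact this.mono_left nhdsWithin_le_nhds,
      hφd1.continuousAt.tendsto.mono_left nhdsWithin_le_nhds,
      hφd2.continuousAt.tendsto.mono_left nhdsWithin_le_nhds⟩
  obtain ⟨f₂, hf2, hcomp⟩ := hv.comp hO hB hφj hφO
  have hu' := hcomp.congr (g := zeroExt Ω u) hO fun x hx => by
    simp only [hψφ x hx.1.1]
  have hOΩ : O ⊆ Ω := Set.inter_subset_right
  have hd1 : ∀ y, derivExt Ω 1 u x₁ ![y] = v₁ (fderiv ℝ φ (ψ z) y) := by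
    intro y
    have h1 := (hu.1.tendsto_derivExt one_le_two x₁).mono_left (nhdsWithin_mono _ hOΩ)
    have h2 : Filter.Tendsto (fun x => innerDeriv Ω 1 u x ![y]) (𝓝[O] (ψ z))
        (𝓝 (derivExt Ω 1 u x₁ ![y])) :=
      ((ContinuousMultilinearMap.apply ℝ (fun _ : Fin 1 => Rn (d + 1)) ℝ ![y]).continuous.tendsto
        _).comp h1
    refine tendsto_nhds_unique h2 ?_
    refine (hu'.3.continuousLinearMap_apply (tendsto_const_nhds (x := y))).congr fun x => ?_
    rw [innerDeriv, iteratedFDeriv_one_apply]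
    rfl
  have hd2 : ∀ x y, derivExt Ω 2 u x₁ ![x, y] = f₂ x y := by
    intro x y
    have h1 := (hu.1.tendsto_derivExt le_rfl x₁).mono_left (nhdsWithin_mono _ hOΩ)
    have h2 : Filter.Tendsto (fun w => innerDeriv Ω 2 u w ![x, y]) (𝓝[O] (ψ z))
        (𝓝 (derivExt Ω 2 u x₁ ![x, y])) :=
      ((ContinuousMultilinearMap.apply ℝ (fun _ : Fin 2 => Rn (d + 1)) ℝ ![x, y]).continuous.tendsto
        _).comp h1
    refine tendsto_nhds_unique h2 ?_
    refine ((hu'.4.continuousLinearMap_apply (tendsto_const_nhds (x := x))).continuousLinearMap_apply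
      (tendsto_const_nhds (x := y))).congr fun w => ?_
    rw [innerDeriv, iteratedFDeriv_two_apply]
    rfl
  obtain ⟨hu0, hLu⟩ := hu.2 x₁ hfr
  let p : Fin (d + 1) → Rn (d + 1) := fun i => fderiv ℝ φ (ψ z) (unitVec i)
  let Q : Fin (d + 1) → Fin (d + 1) → Rn (d + 1) := fun i j =>
    fderiv ℝ (fderiv ℝ φ) (ψ z) (unitVec i) (unitVec j)
  -- The zeroth-order term drops out because `u` vanishes on the boundary.
  have hL : (∑ i, ∑ j, a x₁ i j * (v₂ (p i) (p j) + v₁ (Q i j))) + ∑ i, b x₁ i * v₁ (p i) = 0 := by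
    rw [diffOp, hu0, mul_zero, add_zero] at hLu
    simpa only [hd1, hd2, hf2] using hLu
  rw [boundary_operator_eq hv1 hv2 (hsymm x₁)] at hL
  -- limits of the coefficients
  have hψt' : Filter.Tendsto ψ (𝓝[B] z) (𝓝[closure (Ω : Set (Rn (d + 1)))] (ψ z)) :=
    hψt.mono_right (nhdsWithin_mono _ (hOΩ.trans subset_closure))
  have hzero : ∀ f : Clo Ω → ℝ, Continuous f →
      Filter.Tendsto (fun w => zeroExt Ω f (ψ w)) (𝓝[B] z) (𝓝 (f x₁)) := fun f hf => by
    have := (continuousOn_zeroExt hf (ψ z) x₁.2).tendsto.comp hψt'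
    rwa [show zeroExt Ω f (ψ z) = f x₁ from zeroExt_apply f x₁] at this
  have hψn : Filter.Tendsto ψ (𝓝[B] z) (𝓝 (ψ z)) := hψt.mono_right nhdsWithin_le_nhds
  have hP : ∀ i, Filter.Tendsto (fun w => fderiv ℝ φ (ψ w) (unitVec i)) (𝓝[B] z) (𝓝 (p i)) :=
    fun i => (hφd1.continuousAt.tendsto.comp hψn).continuousLinearMap_apply tendsto_const_nhds
  have hQ : ∀ i j, Filter.Tendsto (fun w => fderiv ℝ (fderiv ℝ φ) (ψ w) (unitVec i) (unitVec j))
      (𝓝[B] z) (𝓝 (Q i j)) := fun i j =>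
    ((hφd2.continuousAt.tendsto.comp hψn).continuousLinearMap_apply
      tendsto_const_nhds).continuousLinearMap_apply tendsto_const_nhds
  set X₀ := ∑ i, ∑ j, (a x₁ i j * τ (p i)) • p j with hX₀
  set Y₀ := (∑ i, ∑ j, a x₁ i j • Q i j) + ∑ i, b x₁ i • p i with hY₀
  have hXt : Filter.Tendsto X (𝓝[B] z) (𝓝 X₀) := by
    refine Filter.Tendsto.congr' (Filter.eventuallyEq_of_mem self_mem_nhdsWithin
      fun w hw => (hX w hw).symm) ?_
    exact tendsto_finsetSum _ fun i _ => tendsto_finsetSum _ fun j _ =>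
      ((hzero _ (ha i j)).mul ((τ.continuous.tendsto _).comp (hP i))).smul (hP j)
  have hYt : Filter.Tendsto Y (𝓝[B] z) (𝓝 Y₀) := by
    refine Filter.Tendsto.congr' (Filter.eventuallyEq_of_mem self_mem_nhdsWithin
      fun w hw => (hY w hw).symm) ?_
    exact (tendsto_finsetSum _ fun i _ => tendsto_finsetSum _ fun j _ =>
      (hzero _ (ha i j)).smul (hQ i j)).add (tendsto_finsetSum _ fun i _ =>
        (hzero _ (hb i)).smul (hP i))
  have hst := (τ.continuous.tendsto _).comp hXt
  have hs0 : 0 < τ X₀ := hδ.trans_le (ge_of_tendsto hst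
    (Filter.eventually_of_mem self_mem_nhdsWithin hs))
  have hq0' : q₀ = (2 * (τ X₀)⁻¹) • X₀ - (2 : ℝ) • e := by
    refine tendsto_nhds_unique hq0 (Filter.Tendsto.congr' (Filter.eventuallyEq_of_mem
      self_mem_nhdsWithin fun w hw => (hq w hw).symm) ?_)
    exact (((hst.inv₀ hs0.ne').const_mul 2).smul hXt).sub tendsto_const_nhds
  have hκ0' : κ₀ = (τ X₀)⁻¹ * τ Y₀ := by
    refine tendsto_nhds_unique hκ0 (Filter.Tendsto.congr' (Filter.eventuallyEq_of_mem
      self_mem_nhdsWithin fun w hw => (hκ w hw).symm) ?_)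
    exact (hst.inv₀ hs0.ne').mul ((τ.continuous.tendsto _).comp hYt)
  rw [hq0', hκ0']
  simp only [map_sub, map_smul, smul_eq_mul]
  have : v₂ e e + (2 * (τ X₀)⁻¹ * v₂ e X₀ - 2 * v₂ e e) + (τ X₀)⁻¹ * τ Y₀ * v₁ e =
      (τ X₀)⁻¹ * (2 * v₂ e X₀ - τ X₀ * v₂ e e + τ Y₀ * v₁ e) := by
    field_simp
    ring
  rw [this, hL, mul_zero]

/-- The right side is the quadratic form of `A` at the covector `ω = τ ∘ P`. Ellipticity reduces the
claim to `‖ω‖ ≥ N⁻¹`, which is Cauchy-Schwarz applied to `⟨ω, y⟩ = τ (P y) = 1`. -/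
theorem normal_component_lower_bound {d : ℕ} {A : Matrix (Fin (d + 1)) (Fin (d + 1)) ℝ} {lam N : ℝ}
    (hlam : 0 < lam) (hA : ∀ ξ : Rn (d + 1), lam * ‖ξ‖ ^ 2 ≤ ∑ i, ∑ j, A i j * ξ i * ξ j)
    {τ : Rn (d + 1) →L[ℝ] ℝ} {P : Rn (d + 1) →L[ℝ] Rn (d + 1)} {y : Rn (d + 1)} (hN : 0 < N)
    (hy : ‖y‖ ≤ N) (hPy : τ (P y) = 1) :
    lam * N⁻¹ ^ 2 ≤ τ (∑ i, ∑ j, (A i j * τ (P (unitVec i))) • P (unitVec j)) := by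
  let ω : Rn (d + 1) := WithLp.toLp 2 fun i => τ (P (unitVec i))
  have h1 : τ (∑ i, ∑ j, (A i j * τ (P (unitVec i))) • P (unitVec j)) =
      ∑ i, ∑ j, A i j * ω i * ω j := by
    simp [ω, map_sum]
  have h2 : inner ℝ ω y = 1 := by
    have hy' : y = ∑ i, y i • unitVec i := by
      ext j
      simp [unitVec, Pi.single_apply]
    have h3 : τ (P y) = ∑ i, y i * τ (P (unitVec i)) := by
      conv_lhs => rw [hy']
      simp only [map_sum, map_smul, smul_eq_mul]
    rw [← hPy, h3, PiLp.inner_apply]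
    simp [ω]
  have h3 : 1 ≤ ‖ω‖ * N := by
    rw [← h2]
    exact (real_inner_le_norm ω y).trans (by gcongr)
  have h4 : N⁻¹ ≤ ‖ω‖ := by
    rw [inv_le_iff_one_le_mul₀ hN]
    exact h3
  rw [h1]
  exact le_trans (by gcongr) (hA ω)

end Local

/-! ### Extension near a boundary point. -/

section LocalExtension

/-- The odd extension of `u` by means of a map `R` from the exterior into `Ω`. -/
noncomputable def oddExt {n : ℕ} (Ω : TopologicalSpace.Opens (Rn n)) (R : Rn n → Rn n)
    (u : Clo Ω → ℝ) (x : Rn n) : ℝ :=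
  open Classical in if x ∈ closure (Ω : Set (Rn n)) then zeroExt Ω u x else -zeroExt Ω u (R x)

/-- Transports `HolderBd.exists_reflection` through the chart. All estimates are made on the convex
half-ball `B`, since `Ω` itself need not be convex. -/
theorem exists_oddExt_holderBd_of_mem_frontier {d : ℕ} {α : ℝ≥0} (hα0 : 0 < α) (hα1 : α ≤ 1)
    {Ω : TopologicalSpace.Opens (Rn (d + 1))}
    (hbdd : Bornology.IsBounded (Ω : Set (Rn (d + 1))))
    (hsmooth : IsHolderSmooth 4 α (Ω : Set (Rn (d + 1))))
    {a : Clo Ω → Matrix (Fin (d + 1)) (Fin (d + 1)) ℝ}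
    {b : Clo Ω → Fin (d + 1) → ℝ} {c : Clo Ω → ℝ}
    (ha : ∀ i j, IsHolderUpToBoundary 2 α Ω (fun x => a x i j))
    (hb : ∀ i, IsHolderUpToBoundary 2 α Ω (fun x => b x i))
    (hsymm : ∀ x, (a x).IsSymm)
    {lam : ℝ} (hlam : 0 < lam) (hell : IsUniformlyElliptic Ω a lam)
    {x₀ : Rn (d + 1)} (hx₀ : x₀ ∈ frontier (Ω : Set (Rn (d + 1)))) :
    ∃ (r : ℝ) (R : Rn (d + 1) → Rn (d + 1)) (C : ℝ), 0 < r ∧ r ≤ 1 / 2 ∧ 0 ≤ C ∧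
      ∀ u ∈ opDomain α Ω a b c, ∀ M, HolderBd (α : ℝ) (Ω : Set (Rn (d + 1))) M 2 (zeroExt Ω u) →
        HolderBd (α : ℝ) (Metric.ball x₀ r) (C * M) 2 (oddExt Ω R u) := by
  classical
  have hα0' : (0 : ℝ) < α := by exact_mod_cast hα0
  have hα1' : (α : ℝ) ≤ 1 := by exact_mod_cast hα1
  obtain ⟨ψ, -, hx₀t, hψH, hφH, hψfr, hψΩ⟩ := hsmooth x₀ hx₀
  set τ := lastCoord d with hτdef
  set e : Rn (d + 1) := unitVec (Fin.last d) with hedef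
  have he : τ e = 1 := lastCoord_unitVec d
  set φ := ψ.symm with hφdef
  -- the chart
  have hfr_of : ∀ z ∈ ψ.source, τ z = 0 → ψ z ∈ frontier (Ω : Set (Rn (d + 1))) := fun z hz h0 =>
    (hψfr.subset ⟨z, ⟨hz, h0⟩, rfl⟩).1
  have hΩ_of : ∀ z ∈ ψ.source, 0 < τ z → ψ z ∈ Ω := fun z hz h0 =>
    (hψΩ.subset ⟨z, ⟨hz, h0⟩, rfl⟩).1
  have hτ_fr : ∀ x ∈ ψ.target, x ∈ frontier (Ω : Set (Rn (d + 1))) → τ (φ x) = 0 := by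
    intro x hx hxf
    obtain ⟨z, ⟨hz, h0⟩, rfl⟩ := hψfr.superset ⟨hxf, hx⟩
    rw [hφdef, ψ.left_inv hz]
    exact h0
  have hτ_Ω : ∀ x ∈ ψ.target, x ∈ Ω → 0 < τ (φ x) := by
    intro x hx hxΩ
    obtain ⟨z, ⟨hz, h0⟩, rfl⟩ := hψΩ.superset ⟨hxΩ, hx⟩
    rw [hφdef, ψ.left_inv hz]
    exact h0
  have hclos_iff : ∀ x ∈ ψ.target, x ∈ closure (Ω : Set (Rn (d + 1))) ↔ 0 ≤ τ (φ x) := by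
    intro x hx
    have hxψ : ψ (φ x) = x := ψ.right_inv hx
    have hxs : φ x ∈ ψ.source := ψ.map_target hx
    constructor
    · intro hxc
      by_cases hxΩ : x ∈ Ω
      · exact (hτ_Ω x hx hxΩ).le
      · refine (hτ_fr x hx ⟨hxc, ?_⟩).ge
        rwa [Ω.isOpen.interior_eq]
    · intro h
      rcases h.eq_or_lt with h | h
      · rw [← hxψ]
        exact frontier_subset_closure (hfr_of _ hxs h.symm)
      · rw [← hxψ]
        exact subset_closure (hΩ_of _ hxs h)
  set z₀ := φ x₀ with hz₀def
  have hz₀s : z₀ ∈ ψ.source := ψ.map_target hx₀t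
  have hz₀ : τ z₀ = 0 := hτ_fr x₀ hx₀t hx₀
  have hψz₀ : ψ z₀ = x₀ := ψ.right_inv hx₀t
  -- Hölder bounds for the chart on small balls
  obtain ⟨r₁, Nφ, hr₁, hr₁', hr₁t, hφ4⟩ := hφH.exists_holderBd hα0 ψ.open_target hx₀t
  obtain ⟨r₂, Nψ, hr₂, hr₂', hr₂s, hψ4⟩ := hψH.exists_holderBd hα0 ψ.open_source hz₀s
  have hV := smallConvex_ball (z := x₀) hr₁'
  set V := Metric.ball x₀ r₁
  obtain ⟨r₃, hr₃, hr₃V⟩ := Metric.mem_nhds_iff.1 ((ψ.continuousAt hz₀s).preimage_mem_nhds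
    (by rw [hψz₀]; exact Metric.ball_mem_nhds x₀ hr₁) : ψ ⁻¹' V ∈ 𝓝 z₀)
  set ρ := min r₂ r₃
  have hρ0 : 0 < ρ := lt_min hr₂ hr₃
  have hρ : ρ ≤ 1 / 2 := (min_le_left _ _).trans hr₂'
  have hρs : Metric.ball z₀ ρ ⊆ ψ.source :=
    (Metric.ball_subset_ball (min_le_left _ _)).trans hr₂s
  have hρV : Set.MapsTo ψ (Metric.ball z₀ ρ) V := fun z hz =>
    hr₃V (Metric.ball_subset_ball (min_le_right _ _) hz)
  have hB := (smallConvex_ball (z := z₀) hρ).inter_halfSpace τ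
  set B := Metric.ball z₀ ρ ∩ {z | 0 < τ z} with hBdef
  have hBball : B ⊆ Metric.ball z₀ ρ := Set.inter_subset_left
  have hψB4 : HolderBd (α : ℝ) B Nψ 4 ψ :=
    hψ4.mono_set (hBball.trans (Metric.ball_subset_ball (min_le_left _ _)))
  have hψB2 : HolderBd (α : ℝ) B Nψ 2 ψ := hψB4.of_le hα1' hB (by norm_num)
  have hBΩ : Set.MapsTo ψ B Ω := fun z hz => hΩ_of z (hρs hz.1) hz.2
  have hBV : Set.MapsTo ψ B V := fun z hz => hρV hz.1
  have hφψ : ∀ w ∈ B, φ (ψ w) = w := fun w hw => ψ.left_inv (hρs hw.1)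
  have hψφ : ∀ x ∈ V, ψ (φ x) = x := fun x hx => ψ.right_inv (hr₁t hx)
  obtain ⟨C₁, hC₁, hcompΩ⟩ := HolderBd.exists_comp hα0' hα1' hB Ω.isOpen hψB2
    (hψB2.lipschitz hB) hBΩ
  obtain ⟨C₂, hC₂, hcompV⟩ := HolderBd.exists_comp hα0' hα1' hB hV.isOpen hψB2
    (hψB2.lipschitz hB) hBV
  -- the coefficients in flat coordinates
  have hcoef : ∀ f : Clo Ω → ℝ, IsHolderUpToBoundary 2 α Ω f →
      ∃ M, HolderBd (α : ℝ) B M 2 (fun z => zeroExt Ω f (ψ z)) := fun f hf => by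
    obtain ⟨M, hM⟩ := hf.exists_holderBd hα0 hbdd
    exact ⟨_, hcompΩ _ _ hM⟩
  let P : Fin (d + 1) → Rn (d + 1) → Rn (d + 1) := fun i z => fderiv ℝ φ (ψ z) (unitVec i)
  let Q : Fin (d + 1) → Fin (d + 1) → Rn (d + 1) → Rn (d + 1) := fun i j z =>
    fderiv ℝ (fderiv ℝ φ) (ψ z) (unitVec i) (unitVec j)
  -- This is where four derivatives of the chart are needed: `Y` contains `D²φ`, and the reflection
  -- must be `C^{2,α}`.
  have hDφ : HolderBd (α : ℝ) V Nφ 2 (fderiv ℝ φ) := hφ4.2.2.of_succ hα1' hV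
  have hDDφ : HolderBd (α : ℝ) V Nφ 2 (fderiv ℝ (fderiv ℝ φ)) := hφ4.2.2.2.2
  have hPH : ∀ i, ∃ M, HolderBd (α : ℝ) B M 2 (P i) := fun i =>
    ⟨_, (hcompV _ _ hDφ).clm hα1' hB (ContinuousLinearMap.apply ℝ _ (unitVec i))⟩
  have hQH : ∀ i j, ∃ M, HolderBd (α : ℝ) B M 2 (Q i j) := fun i j =>
    ⟨_, ((hcompV _ _ hDDφ).clm hα1' hB (ContinuousLinearMap.apply ℝ _ (unitVec i))).clm hα1' hB
      (ContinuousLinearMap.apply ℝ _ (unitVec j))⟩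
  choose Ma hMa using fun i j => hcoef _ (ha i j)
  choose Mb hMb using fun i => hcoef _ (hb i)
  choose MP hMP using hPH
  choose MQ hMQ using hQH
  let X : Rn (d + 1) → Rn (d + 1) := fun w => ∑ i, ∑ j,
    (zeroExt Ω (fun x => a x i j) (ψ w) * τ (P i w)) • P j w
  let Y : Rn (d + 1) → Rn (d + 1) := fun w =>
    (∑ i, ∑ j, zeroExt Ω (fun x => a x i j) (ψ w) • Q i j w) +
      ∑ i, zeroExt Ω (fun x => b x i) (ψ w) • P i w
  have hXH := HolderBd.sum (α := α) (k := 2) Finset.univ hB.isOpen fun i _ =>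
    HolderBd.sum Finset.univ hB.isOpen fun j _ =>
      ((hMa i j).smul hα1' hB ((hMP i).clm hα1' hB τ)).smul hα1' hB (hMP j)
  change HolderBd (α : ℝ) B _ 2 X at hXH
  have hYH := (HolderBd.sum (α := α) (k := 2) Finset.univ hB.isOpen fun i _ =>
    HolderBd.sum Finset.univ hB.isOpen fun j _ => (hMa i j).smul hα1' hB (hMQ i j)).add hB.isOpen
      (HolderBd.sum (α := α) (k := 2) Finset.univ hB.isOpen fun i _ =>
        (hMb i).smul hα1' hB (hMP i))
  change HolderBd (α : ℝ) B _ 2 Y at hYH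
  have hN0 : 0 ≤ Nψ := hψB4.nonneg
  -- The test vector is `Dψ(w) e`, which `Dφ` sends back to `e`. The added one keeps its norm bound
  -- strictly positive.
  have hslow : ∀ w ∈ B, lam * (Nψ * ‖e‖ + 1)⁻¹ ^ 2 ≤ τ (X w) := by
    intro w hw
    let x : Clo Ω := ⟨ψ w, subset_closure (hBΩ hw)⟩
    have hid : fderiv ℝ φ (ψ w) (fderiv ℝ ψ w e) = e := by
      have h1 := ((hφ4.differentiableAt hV.isOpen (hBV hw)).hasFDerivAt.comp w
        (hψB4.differentiableAt hB.isOpen hw).hasFDerivAt).fderiv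
      have h2 : (φ ∘ ψ) =ᶠ[𝓝 w] id := Filter.eventually_of_mem (hB.isOpen.mem_nhds hw) hφψ
      rw [h2.fderiv_eq, fderiv_id] at h1
      exact (congrArg (fun A : Rn (d + 1) →L[ℝ] Rn (d + 1) => A e) h1).symm
    have := normal_component_lower_bound hlam (hell x) (τ := τ) (P := fderiv ℝ φ (ψ w))
      (y := fderiv ℝ ψ w e) (N := Nψ * ‖e‖ + 1) (by positivity)
      (((fderiv ℝ ψ w).le_opNorm e).trans (by
        have := mul_le_mul_of_nonneg_right (hψB4.2.2.bound w hw) (norm_nonneg e)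
        linarith)) (by rw [hid, he])
    refine this.trans_eq ?_
    simp only [X, P]
    congr 1
    refine Finset.sum_congr rfl fun i _ => Finset.sum_congr rfl fun j _ => ?_
    rw [show zeroExt Ω (fun x => a x i j) (ψ w) = a x i j from zeroExt_apply _ x]
  have hδ0 : 0 < lam * (Nψ * ‖e‖ + 1)⁻¹ ^ 2 := by positivity
  obtain ⟨Ms, hsinv⟩ := (hXH.clm hα1' hB τ).exists_inv hα1' hB hδ0 hslow
  -- Dividing the boundary relation by `τ X` gives `v_ee + D²v(e, q) + κ v_e = 0` for this `q` and
  -- `κ`. The term `-2 e` turns `-v_ee` into `+v_ee` and makes `q` tangential.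
  let q : Rn (d + 1) → Rn (d + 1) := fun w => (2 * (τ (X w))⁻¹) • X w - (2 : ℝ) • e
  let κ : Rn (d + 1) → ℝ := fun w => (τ (X w))⁻¹ * τ (Y w)
  have hκH := hsinv.smul hα1' hB (hYH.clm hα1' hB τ)
  change HolderBd (α : ℝ) B _ 2 κ at hκH
  have hqH := (((HolderBd.const (α := α) (S := B) (k := 2) (norm_nonneg (2 : ℝ)) (2 : ℝ)
    le_rfl).smul hα1' hB hsinv).smul hα1' hB hXH).add hB.isOpen
      (HolderBd.const (norm_nonneg (-((2 : ℝ) • e))) (-((2 : ℝ) • e)) le_rfl)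
  replace hqH : HolderBd (α : ℝ) B _ 2 q := hqH.congr hB.isOpen fun w _ => by
    simp only [q, smul_eq_mul, sub_eq_add_neg]
  have hτq : ∀ w ∈ B, τ (q w) = 0 := fun w hw => by
    have h0 : τ (X w) ≠ 0 := (hδ0.trans_le (hslow w hw)).ne'
    simp only [q, map_sub, map_smul, smul_eq_mul, he]
    field_simp
    ring
  obtain ⟨δ, S, hδ, hδρ, hSm, C₃, hC₃, hrefl⟩ := HolderBd.exists_reflection hα0' hα1' he
    (norm_sub_two_lastCoord (d := d)) hz₀ hρ0 hρ hqH hκH hτq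
  -- the neighbourhood of `x₀` in the original coordinates
  obtain ⟨r₄, hr₄, hr₄V⟩ := Metric.mem_nhds_iff.1 ((ψ.symm.continuousAt hx₀t).preimage_mem_nhds
    (Metric.ball_mem_nhds z₀ hδ))
  set r := min r₁ r₄
  have hr0 : 0 < r := lt_min hr₁ hr₄
  have hr : r ≤ 1 / 2 := (min_le_left _ _).trans hr₁'
  have hrV : Metric.ball x₀ r ⊆ V := Metric.ball_subset_ball (min_le_left _ _)
  have hrm : Set.MapsTo φ (Metric.ball x₀ r) (Metric.ball z₀ δ) := fun x hx =>
    hr₄V (Metric.ball_subset_ball (min_le_right _ _) hx)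
  have hrs := smallConvex_ball (z := x₀) hr
  have hφ2 : HolderBd (α : ℝ) (Metric.ball x₀ r) Nφ 2 φ :=
    (hφ4.of_le hα1' hV (by norm_num)).mono_set hrV
  obtain ⟨C₄, hC₄, hcomp₄⟩ := HolderBd.exists_comp hα0' hα1' hrs Metric.isOpen_ball hφ2
    (hφ2.lipschitz hrs) hrm
  -- The constants account for composition with `φ`, the reflection, and composition with `ψ`.
  refine ⟨r, fun x => ψ (S (φ x - (2 * τ (φ x)) • e)), C₄ * (C₃ * C₁), hr0, hr, by positivity,
    fun u hu M hM => ?_⟩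
  have hclosB : ∀ z ∈ Metric.ball z₀ ρ, τ z = 0 → z ∈ closure B := fun z hz h0 =>
    mem_closure_inter_halfSpace he Metric.isOpen_ball hz h0.ge
  have hv := hcompΩ _ _ hM
  have hv0 : ∀ z ∈ Metric.ball z₀ ρ, τ z = 0 → zeroExt Ω u (ψ z) = 0 ∧
      Filter.Tendsto (fun z => zeroExt Ω u (ψ z)) (𝓝[B] z) (𝓝 0) := by
    intro z hz h0
    have hfr := hfr_of z (hρs hz) h0
    let x : Clo Ω := ⟨ψ z, frontier_subset_closure hfr⟩
    have h1 : zeroExt Ω u (ψ z) = 0 := (zeroExt_apply u x).trans (hu.2 x hfr).1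
    refine ⟨h1, ?_⟩
    rw [← h1]
    refine (continuousOn_zeroExt hu.1.continuous (ψ z) x.2).tendsto.comp ?_
    exact tendsto_nhdsWithin_iff.2
      ⟨(ψ.continuousAt (hρs hz)).tendsto.mono_left nhdsWithin_le_nhds,
        Filter.eventually_of_mem self_mem_nhdsWithin fun w hw => subset_closure (hBΩ hw)⟩
  have hw := hrefl _ _ hv hv0 fun z hz h0 v₀ v₁ v₂ q₀ κ₀ hj hq0 hκ0 => by
    obtain ⟨t1, t2⟩ := hj.eq_of_vanishing he Metric.isOpen_ball
      (fun z hz h0 => hv.exists_jetTendsto hα0' hα1' hB (hclosB z hz h0))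
      (fun z hz h0 => (hv0 z hz h0).2) hz h0
    exact jet_condition_of_mem_opDomain (φ := φ) (ψ := ψ) (V := V) (X := X) (Y := Y) hsymm
      (fun i j => (ha i j).continuous) (fun i => (hb i).continuous) hu hB.isOpen hV.isOpen
      (hclosB z hz h0) (hρV hz) (ψ.continuousAt (hρs hz)) (fun w hw => ⟨hBΩ hw, hBV hw⟩) hφψ hψφ
      (ψ.left_inv (hρs hz)) ((hφ4.of_le hα1' hV (by norm_num : 2 ≤ 4)).contDiffOn hα0' hV.isOpen)
      (hfr_of z (hρs hz) h0) hj t1 t2 (fun _ _ => rfl) (fun _ _ => rfl) hδ0 hslow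
      (fun _ _ => rfl) (fun _ _ => rfl) hq0 hκ0
  have hfin := hcomp₄ _ _ hw
  rw [← mul_assoc, ← mul_assoc, mul_assoc C₄] at hfin
  refine hfin.congr hrs.isOpen fun x hx => ?_
  have hxt := hr₁t (hrV hx)
  simp only [oddExt]
  by_cases h : 0 ≤ τ (φ x)
  · rw [if_pos h, if_pos ((hclos_iff x hxt).2 h), hψφ x (hrV hx)]
  · rw [if_neg h, if_neg (fun h' => h ((hclos_iff x hxt).1 h'))]

end LocalExtension

/-! ### Gluing the local extensions by a partition of unity. -/

section GlobalExtension

variable {n : ℕ} {Ω : TopologicalSpace.Opens (Rn n)}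

theorem oddExt_add (R : Rn n → Rn n) (u v : Clo Ω → ℝ) :
    oddExt Ω R (u + v) = oddExt Ω R u + oddExt Ω R v := by
  funext x
  simp only [oddExt, zeroExt_add, Pi.add_apply]
  split_ifs
  · rfl
  · ring

theorem oddExt_smul (R : Rn n → Rn n) (r : ℝ) (u : Clo Ω → ℝ) :
    oddExt Ω R (r • u) = r • oddExt Ω R u := by
  funext x
  simp only [oddExt, zeroExt_smul, Pi.smul_apply, smul_eq_mul]
  split_ifs
  · rfl
  · ring

theorem oddExt_apply (R : Rn n → Rn n) (u : Clo Ω → ℝ) (x : Clo Ω) :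
    oddExt Ω R u x.val = u x := by
  rw [oddExt, if_pos x.2, zeroExt_apply]

theorem enorm_zeroExt_le {u : Clo Ω → ℝ}
    (hu : ∀ x : Clo Ω, x.val ∈ frontier (Ω : Set (Rn n)) → u x = 0) (x : Rn n) :
    ‖zeroExt Ω u x‖ₑ ≤ ⨆ (y : Clo Ω) (_ : y.val ∈ Ω), ‖u y‖ₑ := by
  by_cases hx : ∃ y : Clo Ω, y.val = x
  · obtain ⟨y, rfl⟩ := hx
    rw [zeroExt_apply]
    by_cases hy : y.val ∈ Ω
    · exact le_iSup₂_of_le y hy le_rfl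
    · rw [hu y ⟨y.2, by rwa [Ω.isOpen.interior_eq]⟩, enorm_zero]
      exact zero_le
  · rw [zeroExt, Function.extend_apply' _ _ _ hx]
    simp

/-- No assumption on `R` is needed: where `R x` leaves the closure, `zeroExt` takes the value zero.
-/
theorem enorm_oddExt_le {u : Clo Ω → ℝ}
    (hu : ∀ x : Clo Ω, x.val ∈ frontier (Ω : Set (Rn n)) → u x = 0) (R : Rn n → Rn n) (x : Rn n) :
    ‖oddExt Ω R u x‖ₑ ≤ ⨆ (y : Clo Ω) (_ : y.val ∈ Ω), ‖u y‖ₑ := by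
  rw [oddExt]
  split_ifs
  · exact enorm_zeroExt_le hu x
  · rw [enorm_neg]
    exact enorm_zeroExt_le hu _

/-- The factor counts the `k + 1` suprema and the Hölder seminorm. -/
theorem HolderBd.holderNorm_le {α : ℝ≥0} (hα : 0 < α) {S : Set (Rn n)} (hS : IsOpen S) {k : ℕ}
    {M : ℝ} {f : Rn n → ℝ} (h : HolderBd (α : ℝ) S M k f) :
    holderNorm k α S f ≤ (k + 2 : ℕ) * ENNReal.ofReal M := by
  have hM := h.nonneg
  obtain ⟨-, h1, h2⟩ := (holderBd_iff_iteratedFDeriv (by exact_mod_cast hα) hS hM).1 h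
  have e1 : ∑ j ∈ Finset.range (k + 1), ⨆ x ∈ S, ‖iteratedFDeriv ℝ j f x‖ₑ ≤
      ∑ _j ∈ Finset.range (k + 1), ENNReal.ofReal M := by
    refine Finset.sum_le_sum fun j hj => iSup₂_le fun x hx => ?_
    rw [← ofReal_norm]
    exact ENNReal.ofReal_le_ofReal (h1 j (Nat.le_of_lt_succ (Finset.mem_range.1 hj)) x hx)
  have e2 : eHolderNorm α (S.domRestrict (iteratedFDeriv ℝ k f)) ≤ ENNReal.ofReal M := by
    refine HolderWith.eHolderNorm_le (C := M.toNNReal) fun x y => ?_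
    have h3 : HolderOnWith M.toNNReal α (iteratedFDeriv ℝ k f) S :=
      holderOnWith_iff_norm.2 (by simpa [hM] using h2)
    exact h3 x x.2 y y.2
  refine (add_le_add e1 e2).trans_eq ?_
  rw [Finset.sum_const, Finset.card_range, nsmul_eq_mul]
  push_cast
  ring

theorem HolderBd.of_holderNorm {α : ℝ≥0} (hα : 0 < α) {S : Set (Rn n)} (hS : IsOpen S) {k : ℕ}
    {f : Rn n → ℝ} (hf : ContDiffOn ℝ k f S) (h : holderNorm k α S f ≠ ⊤) :
    HolderBd (α : ℝ) S (holderNorm k α S f).toReal k f := by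
  refine (holderBd_iff_iteratedFDeriv (by exact_mod_cast hα) hS ENNReal.toReal_nonneg).2
    ⟨hf, fun j hj x hx => ?_, ?_⟩
  · rw [← toReal_enorm]
    refine ENNReal.toReal_mono h (le_trans ?_ le_self_add)
    refine le_trans ?_ (Finset.single_le_sum (f := fun j => ⨆ x ∈ S, ‖iteratedFDeriv ℝ j f x‖ₑ)
      (fun _ _ => zero_le) (Finset.mem_range.2 (Nat.lt_succ_of_le hj)))
    exact le_iSup₂_of_le x hx le_rfl
  · have hle : eHolderNorm α (S.domRestrict (iteratedFDeriv ℝ k f)) ≤ holderNorm k α S f :=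
      le_add_self
    have hmem : MemHolder α (S.domRestrict (iteratedFDeriv ℝ k f)) :=
      eHolderNorm_lt_top.1 (hle.trans_lt h.lt_top)
    have h1 := hmem.holderWith
    intro x hx y hy
    have h2 : HolderOnWith (nnHolderNorm α (S.domRestrict (iteratedFDeriv ℝ k f))) α
      (iteratedFDeriv ℝ k f) S := fun x hx y hy => h1 ⟨x, hx⟩ ⟨y, hy⟩
    refine (holderOnWith_iff_norm.1 h2 x hx y hy).trans ?_
    gcongr
    exact ENNReal.toReal_mono h hle

theorem HolderBd.mem_compactHolder {α : ℝ≥0} (hα : 0 < α) {k : ℕ} {M : ℝ} {f : Rn n → ℝ}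
    (h : HolderBd (α : ℝ) Set.univ M k f) (hf : HasCompactSupport f) :
    f ∈ compactHolder n k α := by
  have hM := h.nonneg
  obtain ⟨h0, -, h2⟩ := (holderBd_iff_iteratedFDeriv (by exact_mod_cast hα) isOpen_univ hM).1 h
  exact ⟨contDiffOn_univ.1 h0, hf, M.toNNReal, holderOnWith_univ.1
    (holderOnWith_iff_norm.2 (by simpa [hM] using h2))⟩

/-- The operator is `u ↦ ∑ χᵢ · oddExt Ω Rᵢ u` over a finite cover of the compact closure. All
`oddExt Ω Rᵢ u` equal `u` on that closure, so no compatibility between the reflections is needed. -/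
theorem exists_extension_of_local {α : ℝ≥0} (hα0 : 0 < α) (hα1 : α ≤ 1)
    (hbdd : Bornology.IsBounded (Ω : Set (Rn n))) (D : Submodule ℝ (Clo Ω → ℝ))
    (hD : ∀ u ∈ D, IsHolderUpToBoundary 2 α Ω u ∧
      ∀ x : Clo Ω, x.val ∈ frontier (Ω : Set (Rn n)) → u x = 0)
    (hloc : ∀ x ∈ frontier (Ω : Set (Rn n)),
      ∃ (r : ℝ) (R : Rn n → Rn n) (C : ℝ), 0 < r ∧ r ≤ 1 / 2 ∧ 0 ≤ C ∧ ∀ u ∈ D, ∀ M,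
        HolderBd (α : ℝ) (Ω : Set (Rn n)) M 2 (zeroExt Ω u) →
        HolderBd (α : ℝ) (Metric.ball x r) (C * M) 2 (oddExt Ω R u)) :
    ∃ E : D →ₗ[ℝ] compactHolder n 2 α,
      Function.Injective E ∧
      (∃ C : ℝ≥0, ∀ u : D, holderNorm 2 α Set.univ (E u : Rn n → ℝ) ≤
          C * holderNorm 2 α (Ω : Set (Rn n)) (zeroExt Ω (u : Clo Ω → ℝ))) ∧
      (∀ (u : D) (x : Clo Ω), (E u : Rn n → ℝ) x.val = (u : Clo Ω → ℝ) x) ∧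
      ∀ u : D, (⨆ x : Rn n, ‖(E u : Rn n → ℝ) x‖ₑ) =
          ⨆ (x : Clo Ω) (_ : x.val ∈ Ω), ‖(u : Clo Ω → ℝ) x‖ₑ := by
  have hα0' : (0 : ℝ) < α := by exact_mod_cast hα0
  have hα1' : (α : ℝ) ≤ 1 := by exact_mod_cast hα1
  have hall : ∀ x : Clo Ω, ∃ (r : ℝ) (R : Rn n → Rn n) (C : ℝ), 0 < r ∧ r ≤ 1 / 2 ∧ 0 ≤ C ∧
      ∀ u ∈ D, ∀ M, HolderBd (α : ℝ) (Ω : Set (Rn n)) M 2 (zeroExt Ω u) →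
        HolderBd (α : ℝ) (Metric.ball x.val r) (C * M) 2 (oddExt Ω R u) := by
    intro x
    by_cases hx : x.val ∈ Ω
    · obtain ⟨ε, hε, hsub⟩ := Metric.isOpen_iff.1 Ω.isOpen x.val hx
      have hsub' : Metric.ball x.val (min ε (1 / 2)) ⊆ Ω :=
        (Metric.ball_subset_ball (min_le_left _ _)).trans hsub
      -- For an interior point the ball lies in `Ω`, so the choice of `R` has no effect on it.
      refine ⟨min ε (1 / 2), id, 1, by positivity, min_le_right _ _, zero_le_one,
        fun u _ M hM => ?_⟩
      rw [one_mul]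
      exact (hM.mono_set hsub').congr Metric.isOpen_ball fun y hy =>
        (if_pos (subset_closure (hsub' hy))).symm
    · exact hloc x.val ⟨x.2, by rwa [Ω.isOpen.interior_eq]⟩
  choose r R C hr0 hr hC hloc' using hall
  have hcpt : IsCompact (closure (Ω : Set (Rn n))) := hbdd.isCompact_closure
  obtain ⟨t, ht⟩ := hcpt.elim_finite_subcover (fun x : Clo Ω => Metric.ball x.val (r x / 2))
    (fun _ => Metric.isOpen_ball) fun x hx => Set.mem_iUnion.2
      ⟨⟨x, hx⟩, Metric.mem_ball_self (half_pos (hr0 _))⟩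
  -- Supports lie in the half-radius balls, hence at distance at least `r / 2` from the complement
  -- of the full ball, as `HolderBd.zero_outside` requires.
  obtain ⟨χ, hχ⟩ := SmoothPartitionOfUnity.exists_isSubordinate (modelWithCornersSelf ℝ (Rn n))
    isClosed_closure (fun i : t => Metric.ball i.val.val (r i.val / 2))
    (fun _ => Metric.isOpen_ball) fun x hx => by
      obtain ⟨i, hi, hxi⟩ := Set.mem_iUnion₂.1 (ht hx)
      exact Set.mem_iUnion.2 ⟨⟨i, hi⟩, hxi⟩
  have hχnn : ∀ i x, 0 ≤ χ i x := fun i x => χ.nonneg i x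
  have hχle : ∀ x, ∑ i, χ i x ≤ 1 := fun x => by
    rw [← finsum_eq_sum_of_fintype]
    exact χ.sum_le_one x
  have hχone : ∀ x ∈ closure (Ω : Set (Rn n)), ∑ i, χ i x = 1 := fun x hx => by
    rw [← finsum_eq_sum_of_fintype]
    exact χ.sum_eq_one hx
  have hχs : ∀ i, ContDiff ℝ (⊤ : ℕ∞) (χ i) := fun i => (χ i).contMDiff.contDiff
  have hball : ∀ i : t, SmallConvex (Metric.ball i.val.val (r i.val)) := fun i =>
    smallConvex_ball (hr i.val)
  choose Mχ hMχ using fun i : t => (hχs i).exists_holderBd hα1' (hball i) 2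
  have hsupp : ∀ i : t, tsupport (χ i) ⊆ Metric.ball i.val.val (r i.val / 2) := fun i => hχ i
  let T : (Clo Ω → ℝ) →ₗ[ℝ] (Rn n → ℝ) :=
    { toFun := fun u x => ∑ i, χ i x * oddExt Ω (R i.val) u x
      map_add' := fun u v => by
        funext x
        simp only [oddExt_add, Pi.add_apply, mul_add, Finset.sum_add_distrib]
      map_smul' := fun s u => by
        funext x
        simp only [oddExt_smul, Pi.smul_apply, smul_eq_mul, Finset.mul_sum, RingHom.id_apply]
        exact Finset.sum_congr rfl fun i _ => by ring }
  let K : ℝ := ∑ i : t, max 1 ((r i.val / 2) ^ (α : ℝ))⁻¹ * (2 ^ (2 + 1) * Mχ i * C i.val)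
  have hT : ∀ u ∈ D, ∀ M, HolderBd (α : ℝ) (Ω : Set (Rn n)) M 2 (zeroExt Ω u) →
      HolderBd (α : ℝ) Set.univ (K * M) 2 (T u) := by
    intro u hu M hM
    rw [Finset.sum_mul]
    refine HolderBd.sum Finset.univ isOpen_univ fun i _ => ?_
    have h1 := (hMχ i).smul hα1' (hball i) (hloc' i.val u hu M hM)
    have hi := hr0 i.val
    have h2 := h1.zero_outside hα0' Metric.isOpen_ball (isClosed_tsupport (χ i))
      (half_pos hi) ((hsupp i).trans (Metric.ball_subset_ball (by linarith)))
      (fun x hx y hy => ?_) fun x hx => ?_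
    · refine h2.mono_const (le_of_eq ?_)
      ring
    · have h3 := Metric.mem_ball.1 (hsupp i hx)
      rw [Metric.mem_ball, not_lt] at hy
      rw [← dist_eq_norm]
      linarith [dist_triangle_left y i.val.val x]
    · rw [image_eq_zero_of_notMem_tsupport hx, zero_smul]
  have hTc : ∀ u, HasCompactSupport (T u) := by
    intro u
    refine HasCompactSupport.intro (K := ⋃ i, tsupport (χ i)) ?_ fun x hx => ?_
    · exact isCompact_iUnion fun i => (ProperSpace.isCompact_closedBall i.val.val
        (r i.val / 2)).of_isClosed_subset (isClosed_tsupport _)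
          ((hsupp i).trans Metric.ball_subset_closedBall)
    · refine Finset.sum_eq_zero fun i _ => ?_
      rw [image_eq_zero_of_notMem_tsupport fun h => hx (Set.mem_iUnion.2 ⟨i, h⟩), zero_mul]
  have hfin : ∀ u ∈ D, HolderBd (α : ℝ) (Ω : Set (Rn n))
      (holderNorm 2 α (Ω : Set (Rn n)) (zeroExt Ω u)).toReal 2 (zeroExt Ω u) ∧
      holderNorm 2 α (Ω : Set (Rn n)) (zeroExt Ω u) ≠ ⊤ := by
    intro u hu
    obtain ⟨M, hM⟩ := (hD u hu).1.exists_holderBd hα0 hbdd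
    have h1 : holderNorm 2 α (Ω : Set (Rn n)) (zeroExt Ω u) ≠ ⊤ :=
      ((hM.holderNorm_le hα0 Ω.isOpen).trans_lt
        (ENNReal.mul_lt_top (ENNReal.natCast_lt_top _) ENNReal.ofReal_lt_top)).ne
    exact ⟨.of_holderNorm hα0 Ω.isOpen (hM.contDiffOn hα0' Ω.isOpen) h1, h1⟩
  have hTu : ∀ u (x : Clo Ω), T u x.val = u x := by
    intro u x
    change ∑ i, χ i x.val * oddExt Ω (R i.val) u x.val = u x
    simp only [oddExt_apply, ← Finset.sum_mul, hχone x.val x.2, one_mul]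
  refine ⟨(T.comp D.subtype).codRestrict _ fun u =>
    (hT u u.2 _ (hfin u u.2).1).mem_compactHolder hα0 (hTc u), fun u v huv => ?_,
    -- The four is `k + 2` from `HolderBd.holderNorm_le` with `k = 2`.
    ⟨(4 : ℝ≥0) * K.toNNReal, fun u => ?_⟩, fun u x => hTu u x, fun u => le_antisymm ?_ ?_⟩
  · refine Subtype.ext (funext fun x => ?_)
    rw [← hTu u x, ← hTu v x]
    exact congrFun (congrArg Subtype.val huv) x.val
  · obtain ⟨h1, h2⟩ := hfin u u.2
    refine ((hT u u.2 _ h1).holderNorm_le hα0 isOpen_univ).trans ?_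
    rw [ENNReal.ofReal_mul' ENNReal.toReal_nonneg, ENNReal.ofReal_toReal h2, ← mul_assoc]
    simp [ENNReal.ofReal]
  · refine iSup_le fun x => ?_
    change ‖∑ i, χ i x * oddExt Ω (R i.val) u x‖ₑ ≤ _
    refine (enorm_sum_le _ _).trans ?_
    calc ∑ i, ‖χ i x * oddExt Ω (R i.val) u x‖ₑ
        ≤ ∑ i, ENNReal.ofReal (χ i x) * ⨆ (y : Clo Ω) (_ : y.val ∈ Ω), ‖(u : Clo Ω → ℝ) y‖ₑ := by
          refine Finset.sum_le_sum fun i _ => ?_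
          rw [enorm_mul, Real.enorm_of_nonneg (hχnn i x)]
          gcongr
          exact enorm_oddExt_le (hD u u.2).2 _ _
      _ = ENNReal.ofReal (∑ i, χ i x) * ⨆ (y : Clo Ω) (_ : y.val ∈ Ω), ‖(u : Clo Ω → ℝ) y‖ₑ := by
          rw [ENNReal.ofReal_sum_of_nonneg fun i _ => hχnn i x, Finset.sum_mul]
      _ ≤ 1 * ⨆ (y : Clo Ω) (_ : y.val ∈ Ω), ‖(u : Clo Ω → ℝ) y‖ₑ := by
          gcongr
          exact ENNReal.ofReal_le_one.2 (hχle x)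
      _ = _ := one_mul _
  · refine iSup₂_le fun x _ => le_iSup_of_le x.val ?_
    exact (congrArg (‖·‖ₑ) (hTu u x).symm).le

end GlobalExtension

theorem mainTheorem1 (d : ℕ) (α : ℝ≥0) (hα0 : 0 < α) (hα1 : α < 1)
    (Ω : TopologicalSpace.Opens (Rn (d + 1)))
    (hconn : IsConnected (Ω : Set (Rn (d + 1))))
    (hbdd : Bornology.IsBounded (Ω : Set (Rn (d + 1))))
    (hsmooth : IsHolderSmooth 4 α (Ω : Set (Rn (d + 1))))
    (a : Clo Ω → Matrix (Fin (d + 1)) (Fin (d + 1)) ℝ)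
    (b : Clo Ω → Fin (d + 1) → ℝ) (c : Clo Ω → ℝ)
    (ha : ∀ i j, IsHolderUpToBoundary 2 α Ω (fun x => a x i j))
    (hb : ∀ i, IsHolderUpToBoundary 2 α Ω (fun x => b x i))
    (hc : IsHolderUpToBoundary 2 α Ω c)
    (hsymm : ∀ x, (a x).IsSymm)
    (lam : ℝ) (hlam : 0 < lam) (hell : IsUniformlyElliptic Ω a lam) :
    ∃ E : opDomain α Ω a b c →ₗ[ℝ] compactHolder (d + 1) 2 α,
      Function.Injective E ∧
      (∃ C : ℝ≥0, ∀ u : opDomain α Ω a b c,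
        holderNorm 2 α Set.univ (E u : Rn (d + 1) → ℝ) ≤
          C * holderNorm 2 α (Ω : Set (Rn (d + 1))) (zeroExt Ω (u : Clo Ω → ℝ))) ∧
      (∀ (u : opDomain α Ω a b c) (x : Clo Ω),
        (E u : Rn (d + 1) → ℝ) x.val = (u : Clo Ω → ℝ) x) ∧
      ∀ u : opDomain α Ω a b c,
        (⨆ x : Rn (d + 1), ‖(E u : Rn (d + 1) → ℝ) x‖ₑ) =
          ⨆ (x : Clo Ω) (_ : x.val ∈ Ω), ‖(u : Clo Ω → ℝ) x‖ₑ :=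
  exists_extension_of_local hα0 hα1.le hbdd _ (fun _ hu => ⟨hu.1, fun x hx => (hu.2 x hx).1⟩)
    fun _ hx => exists_oddExt_holderBd_of_mem_frontier hα0 hα1.le hbdd hsmooth ha hb hsymm hlam
      hell hx
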